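/- The language of urelement set theory has a binary relation $\in$ and a unary predicate $\mathscr A$ ("is a urelement"); objects that are not urelements are called sets. $\mathrm{ZFU}_{\mathrm R}$ is the first-order theory consisting of: urelements have no members; Extensionality for sets; Foundation; Pairing; Union; Powerset; Infinity; and the schemas of Separation and Replacement (with parameters). Besides the Axiom of Choice (AC), we consider the following principles. - Collection: for every formula $\varphi$, $\forall w,u\,\bigl(\forall x\in w\,\exists y\,\varphi(x,y,u)\to\exists v\,\forall x\in w\,\exists y\in v\,\varphi(x,y,u)\bigr)$. - Reflection: for every formula $\varphi(x_1,\dots,x_n)$ and every set $x$ there is a transitive set $t\supseteq x$ such that $\varphi(x_1,\dots,x_n)\leftrightarrow\varphi^t(x_1,\dots,x_n)$ for all $x_1,\dots,x_n\in t$. - Plenitude: every ordinal (i.e. transitive pure set well-ordered by $\in$, where pure means that no urelement lies in the transitive closure) is equinumerous with a set of urelements. Let $U$ be a model of $\mathrm{ZFU}_{\mathrm R}$; all of the following notions are understood in $U$. Let $A$ be a set of urelements and let $\mathcal G_A$ be a group of permutations of $A$. Every $\pi\in\mathcal G_A$ acts on all objects: it is the identity on urelements outside $A$, and $\pi x=\{\pi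 y: y\in x\}$ for sets $x$. Put $\mathrm{sym}(x)=\{\pi\in\mathcal G_A:\pi x=x\}$. Let $\mathcal F$ be a normal filter on $\mathcal G_A$, i.e. a non-empty set of subgroups of $\mathcal G_A$ that contains $\mathrm{sym}(a)$ for every urelement $a$ and is closed under supergroups (within $\mathcal G_A$), finite intersections, and conjugation by elements of $\mathcal G_A$. Call $x$ symmetric if $\mathrm{sym}(x)\in\mathcal F$, and let $W$ be the permutation model determined by $\mathcal F$: the class of all hereditarily symmetric objects, i.e. of all $x$ such that every element of the transitive closure of $\{x\}$ is symmetric. Then, $W$ being equipped with the relations $\in$ and $\mathscr A$ inherited from $U$: 1. $W\models\mathrm{ZFU}_{\mathrm R}$; 2. if $U\models$ Collection, then $W\models$ Collection; 3. if $U\models$ Plenitude, then $W\models$ Plenitude; 4. if $U\models$ Reflection $+$ AC, then $W\models$ Reflection. -/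

import Mathlib

/-! Urelement set theory is treated model-theoretically: a universe is an arbitrary first-order
structure for the language with membership and a unary predicate for urelements.  All
set-theoretic notions below (functions, ordinals, groups, filters, ...) are the internal ones:
every quantifier ranges over the objects of the structure. -/

namespace UrSet

open FirstOrder

/-- The relation symbols of urelement set theory. -/
inductive RelSym : ℕ → Type
  | mem : RelSym 2
  | ur : RelSym 1

/-- The first-order language of urelement set theory. -/
def lang : Language := ⟨fun _ => Empty, RelSym⟩

/-- A class `C` of objects as a structure, with the relations inherited from `M`.  Truth of `φ`
in it is truth in `M` of the relativization of `φ` to `C`. -/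
instance classStructure {M : Type*} [lang.Structure M] (C : Set M) : lang.Structure C where
  funMap := fun f _ => Empty.elim f
  RelMap := fun r v => Language.Structure.RelMap r (fun i => (v i : M))

section Basic

variable {M : Type*} [lang.Structure M]

/-- `x` is a member of `y`. -/
def Mem (x y : M) : Prop := Language.Structure.RelMap (L := lang) RelSym.mem ![x, y]

/-- `x` is a urelement. -/
def Ur (x : M) : Prop := Language.Structure.RelMap (L := lang) RelSym.ur ![x]

/-- `x` is a set, i.e. not a urelement. -/
def IsSet (x : M) : Prop := ¬ Ur x

/-- Every member of `x` is a member of `y`. -/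
def Sub (x y : M) : Prop := ∀ z, Mem z x → Mem z y

/-- `A` is a set of urelements. -/
def IsUrSet (A : M) : Prop := IsSet A ∧ ∀ a, Mem a A → Ur a

/-- `t` is a transitive set. -/
def IsTransSet (t : M) : Prop := IsSet t ∧ ∀ y, Mem y t → Sub y t

/-- `y` belongs to the transitive closure of `x`, i.e. to every transitive set including `x`. -/
def InTC (y x : M) : Prop := ∀ t, IsTransSet t → Sub x t → Mem y t

/-- `x` is a pure set: there are no urelements in the transitive closure of `{x}`. -/
def IsPure (x : M) : Prop := IsSet x ∧ ∀ y, InTC y x → IsSet y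

/-- `p = {x, y}`. -/
def IsUPair (p x y : M) : Prop := ∀ w, Mem w p ↔ w = x ∨ w = y

/-- `p` is the Kuratowski ordered pair `⟨x, y⟩ = {{x}, {x, y}}`. -/
def IsOPair (p x y : M) : Prop := ∃ s t, IsUPair s x x ∧ IsUPair t x y ∧ IsUPair p s t

/-- `⟨x, y⟩ ∈ f`. -/
def App (f x y : M) : Prop := ∃ p, IsOPair p x y ∧ Mem p f

/-- `f` is a function with domain `d`. -/
def IsFunOn (f d : M) : Prop :=
  IsSet f ∧ (∀ p, Mem p f → ∃ x y, Mem x d ∧ IsOPair p x y) ∧ ∀ x, Mem x d → ∃! y, App f x y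

/-- `f` is a bijection from `a` onto `b`. -/
def IsBij (f a b : M) : Prop :=
  IsFunOn f a ∧ (∀ x y, App f x y → Mem y b) ∧ ∀ y, Mem y b → ∃! x, App f x y

/-- `a` and `b` are equinumerous. -/
def Equinum (a b : M) : Prop := ∃ f, IsBij f a b

/-- `α` is an ordinal: a transitive pure set well-ordered by membership. -/
def IsOrdinal (α : M) : Prop :=
  IsTransSet α ∧ IsPure α ∧
  (∀ x, Mem x α → ¬ Mem x x) ∧
  (∀ x y z, Mem x α → Mem y α → Mem z α → Mem x y → Mem y z → Mem x z) ∧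
  (∀ x y, Mem x α → Mem y α → Mem x y ∨ x = y ∨ Mem y x) ∧
  (∀ s, Sub s α → (∃ x, Mem x s) → ∃ x, Mem x s ∧ ∀ y, Mem y s → x = y ∨ Mem x y)

end Basic

section Axioms

variable (M : Type*) [lang.Structure M]

/-- `M` is a model of ZF with urelements, formulated with Replacement.  The parameters of the
two schemas are the tuple `p`. -/
structure ZFUR : Prop where
  ur_no_mem : ∀ a x : M, Ur a → ¬ Mem x a
  extensionality : ∀ x y : M, IsSet x → IsSet y → (∀ z, Mem z x ↔ Mem z y) → x = y
  foundation : ∀ x : M, (∃ y, Mem y x) → ∃ y, Mem y x ∧ ∀ z, Mem z y → ¬ Mem z x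
  pairing : ∀ x y : M, ∃ p, IsSet p ∧ ∀ w, Mem w p ↔ w = x ∨ w = y
  union : ∀ x : M, IsSet x → ∃ u, IsSet u ∧ ∀ z, Mem z u ↔ ∃ y, Mem y x ∧ Mem z y
  powerset : ∀ x : M, IsSet x → ∃ p, IsSet p ∧ ∀ y, Mem y p ↔ IsSet y ∧ Sub y x
  infinity : ∃ s : M, IsSet s ∧ (∃ e, Mem e s ∧ IsSet e ∧ ∀ z, ¬ Mem z e) ∧
    ∀ x, Mem x s → ∃ y, Mem y s ∧ ∀ z, Mem z y ↔ Mem z x ∨ z = x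
  separation : ∀ (n : ℕ) (φ : lang.Formula (Fin (n + 1))) (p : Fin n → M) (x : M), IsSet x →
    ∃ v, IsSet v ∧ ∀ y, Mem y v ↔ Mem y x ∧ φ.Realize (Matrix.vecCons y p)
  replacement : ∀ (n : ℕ) (φ : lang.Formula (Fin (n + 2))) (p : Fin n → M) (w : M), IsSet w →
    (∀ x, Mem x w → ∃! y, φ.Realize (Matrix.vecCons x (Matrix.vecCons y p))) →
    ∃ v, IsSet v ∧ ∀ y, Mem y v ↔
      ∃ x, Mem x w ∧ φ.Realize (Matrix.vecCons x (Matrix.vecCons y p))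

/-- The Axiom of Choice: every set of nonempty sets has a choice function. -/
def Choice : Prop :=
  ∀ x : M, IsSet x → (∀ y, Mem y x → ∃ z, Mem z y) →
    ∃ f, IsFunOn f x ∧ ∀ y z, App f y z → Mem z y

/-- The Collection Principle (a schema). -/
def Collection : Prop :=
  ∀ (n : ℕ) (φ : lang.Formula (Fin (n + 2))) (p : Fin n → M) (w : M), IsSet w →
    (∀ x, Mem x w → ∃ y, φ.Realize (Matrix.vecCons x (Matrix.vecCons y p))) →
    ∃ v, IsSet v ∧ ∀ x, Mem x w →
      ∃ y, Mem y v ∧ φ.Realize (Matrix.vecCons x (Matrix.vecCons y p))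

/-- The Reflection Principle (a schema): for every formula `φ`, every set `x` is included in a
transitive set `t` such that `φ` is equivalent to its relativization to `t` for all arguments
from `t`. -/
def Reflection : Prop :=
  ∀ (n : ℕ) (φ : lang.Formula (Fin n)) (x : M), IsSet x →
    ∃ t, IsTransSet t ∧ Sub x t ∧
      ∀ a : Fin n → {y : M | Mem y t}, φ.Realize (fun i => (a i : M)) ↔ φ.Realize a

/-- Plenitude: every ordinal is equinumerous with a set of urelements. -/
def Plenitude : Prop :=
  ∀ α : M, IsOrdinal α → ∃ B, IsUrSet B ∧ Equinum B α

end Axioms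

section PermutationModels

variable {M : Type*} [lang.Structure M]

/-- `H` is a group of permutations of `A`. -/
structure IsPermGroup (A H : M) : Prop where
  isSet : IsSet H
  perm : ∀ π, Mem π H → IsBij π A A
  one : ∃ ι, Mem ι H ∧ ∀ a, Mem a A → App ι a a
  mul : ∀ π ρ, Mem π H → Mem ρ H →
    ∃ σ, Mem σ H ∧ ∀ a c, App σ a c ↔ ∃ b, App ρ a b ∧ App π b c
  inv : ∀ π, Mem π H → ∃ ρ, Mem ρ H ∧ ∀ a b, App ρ a b ↔ App π b a

/-- `π x = y`, where the permutation `π` of the set `A` of urelements acts as the identity on the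
other urelements and by `π z = {π v : v ∈ z}` on sets.  The recursion along membership is
expressed by a function `f` on a transitive set `t` that satisfies the recursion clauses. -/
def Act (A π x y : M) : Prop :=
  ∃ t f, IsTransSet t ∧ IsFunOn f t ∧
    (∀ z w, App f z w →
      (Ur z → Mem z A → App π z w) ∧
      (Ur z → ¬ Mem z A → w = z) ∧
      (IsSet z → IsSet w ∧ ∀ u, Mem u w ↔ ∃ v, Mem v z ∧ App f v u)) ∧
    Mem x t ∧ App f x y

/-- `s = sym(x) = {π ∈ G : π x = x}`. -/
def IsSym (A G x s : M) : Prop := IsSet s ∧ ∀ π, Mem π s ↔ Mem π G ∧ Act A π x x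

/-- `F` is a normal filter on the group `G` of permutations of `A`. -/
structure IsNormalFilter (A G F : M) : Prop where
  isSet : IsSet F
  nonempty : ∃ H, Mem H F
  subgroup : ∀ H, Mem H F → IsPermGroup A H ∧ Sub H G
  sym_ur : ∀ a, Ur a → ∃ s, IsSym A G a s ∧ Mem s F
  supergroup : ∀ H K, Mem H F → IsPermGroup A K → Sub K G → Sub H K → Mem K F
  inter : ∀ H K, Mem H F → Mem K F → ∃ L, Mem L F ∧ ∀ π, Mem π L ↔ Mem π H ∧ Mem π K
  /-- `π H π⁻¹ ∈ F`; here `σ = π ρ π⁻¹` maps `π b` to `π d` whenever `ρ b = d`. -/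
  conj : ∀ π H, Mem π G → Mem H F → ∃ K, Mem K F ∧ ∀ σ, Mem σ K ↔
    Mem σ G ∧ ∃ ρ, Mem ρ H ∧
      ∀ a c, App σ a c ↔ ∃ b d, App π b a ∧ App ρ b d ∧ App π d c

/-- `x` is symmetric with respect to `F`: `sym(x) ∈ F`. -/
def IsSymmetric (A G F x : M) : Prop := ∃ s, IsSym A G x s ∧ Mem s F

/-- The permutation model determined by `F`: the class of all hereditarily symmetric objects,
i.e. objects `x` such that all elements of the transitive closure of `{x}` are symmetric. -/
def permModel (A G F : M) : Set M :=
  {x | IsSymmetric A G F x ∧ ∀ y, InTC y x → IsSymmetric A G F y}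

end PermutationModels

end UrSet

/-! Write `W` for the permutation model and `G` for the group. A conjugate of a support of `x`
supports `π x`, so every `π` in `G` maps the transitive class `W` onto itself and is an automorphism
of it. Truth in `W` is therefore invariant under every `π` that fixes the parameters
(`NormalSystem.realize_act`).

ZFU_R: a set of elements of `W` that is cut out in `U` by a condition about `W` is invariant under a
common support of the parameters, hence belongs to `W` (`NormalSystem.exists_of_small`). For
Replacement, the image is already a set in `U`, and it is invariant for the same reason.

Collection: collect witnesses in `U`, keep those in `W`, and close under `G`. The resulting set is
`G`-invariant and so belongs to `W`.

Plenitude: every ordinal of `W` is an ordinal of `U`. In `U` it is equinumerous with a set `B` of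
urelements that avoids `A` (`Plenitude.exists_avoiding`, by Hartogs' theorem and a collapse).
Elements of `B` and pure sets are fixed by all of `G`, so `B` and the bijection are hereditarily
fixed and lie in `W`.

Reflection: reflect in `U`, simultaneously, the definition of `W`, the relativization of `φ` to `W`,
and the fact that each object lies in a transitive `G`-invariant set. The last makes the reflecting
set `T` closed under `G`, so `T ∩ W` belongs to `W`, and it reflects `φ` there.

The schemas of `U` apply only to first-order conditions, so every class in use must be definable
with parameters. `DefPred` and `DefFun` leave this bookkeeping to instance search. -/

namespace UrSet

open FirstOrder Language

/-! ### Definability with parameters, derived by instance search -/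

section Definability

variable {M : Type*} [lang.Structure M] {α β γ : Type}

/-- `P` is first-order definable with finitely many parameters. -/
class DefPred (P : (α → M) → Prop) : Prop where
  exists_formula : ∃ (ι : Type) (_ : Finite ι) (p : ι → M) (φ : lang.Formula (ι ⊕ α)),
    ∀ v, φ.Realize (Sum.elim p v) ↔ P v

/-- The function `f` has a definable graph. -/
class DefFun (f : (α → M) → M) : Prop where
  graph : DefPred (fun v : Option α → M => v none = f (fun i => v (some i)))

theorem DefPred.congr {P Q : (α → M) → Prop} (h : DefPred P) (hPQ : ∀ v, P v ↔ Q v) :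
    DefPred Q := by
  have : P = Q := funext fun v => propext (hPQ v)
  rwa [← this]

theorem DefPred.comap {P : (β → M) → Prop} (h : DefPred P) (g : β → α) :
    DefPred (fun v : α → M => P (fun i => v (g i))) := by
  obtain ⟨ι, hι, p, φ, hφ⟩ := h
  refine ⟨ι, hι, p, φ.relabel (Sum.map id g), fun v => ?_⟩
  rw [Formula.realize_relabel, ← hφ, Sum.elim_comp_map]
  rfl

instance DefPred.imp {P Q : (α → M) → Prop} [hP : DefPred P] [hQ : DefPred Q] :
    DefPred (fun v => P v → Q v) := by
  obtain ⟨ι, hι, p, φ, hφ⟩ := hP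
  obtain ⟨κ, hκ, q, ψ, hψ⟩ := hQ
  refine ⟨ι ⊕ κ, inferInstance, Sum.elim p q,
    (φ.relabel (Sum.map Sum.inl id)).imp (ψ.relabel (Sum.map Sum.inr id)), fun v => ?_⟩
  rw [Formula.realize_imp, Formula.realize_relabel, Formula.realize_relabel, Sum.elim_comp_map,
    Sum.elim_comp_map, Sum.elim_comp_inl, Sum.elim_comp_inr, Function.comp_id, hφ, hψ]

instance DefPred.false : DefPred (fun _ : α → M => False) :=
  ⟨Empty, inferInstance, Empty.elim, ⊥, fun _ => Iff.rfl⟩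

instance DefPred.not {P : (α → M) → Prop} [DefPred P] : DefPred (fun v => ¬ P v) :=
  DefPred.imp (Q := fun _ => False)

instance DefPred.true : DefPred (fun _ : α → M => True) :=
  DefPred.congr (P := fun _ => ¬ False) inferInstance (by simp)

instance DefPred.or {P Q : (α → M) → Prop} [DefPred P] [DefPred Q] :
    DefPred (fun v => P v ∨ Q v) :=
  DefPred.congr (P := fun v => ¬ P v → Q v) inferInstance fun _ => by tauto

instance DefPred.and {P Q : (α → M) → Prop} [hP : DefPred P] [hQ : DefPred Q] :
    DefPred (fun v => P v ∧ Q v) :=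
  DefPred.congr (P := fun v => ¬ (P v → ¬ Q v)) inferInstance fun _ => by tauto

instance DefPred.iff {P Q : (α → M) → Prop} [DefPred P] [DefPred Q] :
    DefPred (fun v => P v ↔ Q v) :=
  DefPred.congr (P := fun v => (P v → Q v) ∧ (Q v → P v)) inferInstance fun _ => by tauto

theorem DefPred.exFinite [Finite β] {P : (α ⊕ β → M) → Prop} (h : DefPred P) :
    DefPred (fun v : α → M => ∃ w : β → M, P (Sum.elim v w)) := by
  obtain ⟨ι, hι, p, φ, hφ⟩ := h
  refine ⟨ι, hι, p, (φ.relabel (Equiv.sumAssoc ι α β).symm).iExs β, fun v => ?_⟩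
  rw [Formula.realize_iExs]
  refine exists_congr fun w => ?_
  rw [Formula.realize_relabel, ← hφ]
  refine iff_of_eq (congrArg _ (funext fun i => ?_))
  rcases i with i | i | i <;> rfl

/-- The bound variable is the fresh index `none`. In this shape instance search can pass under
quantifiers one at a time. -/
theorem DefPred.ex {P : (α → M) → M → Prop}
    (h : DefPred (fun v : Option α → M => P (fun i => v (some i)) (v none))) :
    DefPred (fun v => ∃ x, P v x) := by
  refine (DefPred.exFinite (β := Unit)
    (h.comap (fun i : Option α => i.elim (Sum.inr ()) Sum.inl))).congr fun v => ?_
  constructor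
  · rintro ⟨w, hw⟩
    exact ⟨_, hw⟩
  · rintro ⟨x, hx⟩
    exact ⟨fun _ => x, hx⟩

instance DefPred.exists {P : (α → M) → M → Prop}
    [h : DefPred (fun v : Option α → M => P (fun i => v (some i)) (v none))] :
    DefPred (fun v => ∃ x, P v x) := h.ex

instance DefPred.forall {P : (α → M) → M → Prop}
    [h : DefPred (fun v : Option α → M => P (fun i => v (some i)) (v none))] :
    DefPred (fun v => ∀ x, P v x) :=
  DefPred.congr (P := fun v => ¬ ∃ x, ¬ P v x) inferInstance fun _ => by simp

theorem DefPred.forallFinite [Finite β] {P : β → (α → M) → Prop} (h : ∀ b, DefPred (P b)) :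
    DefPred (fun v => ∀ b, P b v) := by
  choose ι hι p φ hφ using fun b => (h b).exists_formula
  refine ⟨Σ b, ι b, inferInstance, fun x => p x.1 x.2,
    BoundedFormula.iInf fun b => (φ b).relabel (Sum.map (Sigma.mk b) id), fun v => ?_⟩
  rw [Formula.Realize, BoundedFormula.realize_iInf]
  refine forall_congr' fun b => ?_
  rw [← Formula.Realize, Formula.realize_relabel, ← hφ, Sum.elim_comp_map]
  rfl

instance DefFun.var (i : α) : DefFun (fun v : α → M => v i) :=
  ⟨⟨Empty, inferInstance, Empty.elim,
    Term.equal (Term.var (Sum.inr none)) (Term.var (Sum.inr (some i))), fun v => by simp⟩⟩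

instance DefFun.const (c : M) : DefFun (fun _ : α → M => c) :=
  ⟨⟨Unit, inferInstance, fun _ => c,
    Term.equal (Term.var (Sum.inr none)) (Term.var (Sum.inl ())), fun v => by simp⟩⟩

/-- The substituted values are quantified away through their graphs: `∃ w, w = t v ∧ P w`. Hence a
relation need be treated only at variables, and definable functions may then stand in its argument
places like terms. -/
theorem DefPred.subst [Finite β] {P : (β → M) → Prop} (h : DefPred P) {t : β → (α → M) → M}
    (ht : ∀ i, DefFun (t i)) : DefPred (fun v => P (fun i => t i v)) := by
  have h₁ : DefPred (fun v : α ⊕ β → M => (∀ i, v (Sum.inr i) = t i (fun j => v (Sum.inl j))) ∧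
      P (fun i => v (Sum.inr i))) := by
    have := h.comap (α := α ⊕ β) Sum.inr
    have : DefPred (fun v : α ⊕ β → M => ∀ i, v (Sum.inr i) = t i (fun j => v (Sum.inl j))) :=
      DefPred.forallFinite fun i =>
        (ht i).graph.comap (fun j : Option α => j.elim (Sum.inr i) Sum.inl)
    exact DefPred.and
  refine h₁.exFinite.congr fun v => ?_
  constructor
  · rintro ⟨w, hw, h⟩
    have : w = fun i => t i v := funext hw
    rw [← this]
    exact h
  · intro h
    exact ⟨fun i => t i v, fun i => rfl, h⟩

theorem DefPred.subst₁ {R : M → Prop} (h : DefPred (fun v : Unit → M => R (v ())))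
    {a : (α → M) → M} [ha : DefFun a] : DefPred (fun v => R (a v)) :=
  h.subst (t := fun _ => a) fun _ => ha

theorem DefPred.subst₂ {R : M → M → Prop} (h : DefPred (fun v : Fin 2 → M => R (v 0) (v 1)))
    {a b : (α → M) → M} [ha : DefFun a] [hb : DefFun b] : DefPred (fun v => R (a v) (b v)) :=
  h.subst (t := ![a, b]) (by intro i; fin_cases i <;> assumption)

theorem DefPred.subst₃ {R : M → M → M → Prop}
    (h : DefPred (fun v : Fin 3 → M => R (v 0) (v 1) (v 2)))
    {a b c : (α → M) → M} [ha : DefFun a] [hb : DefFun b] [hc : DefFun c] :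
    DefPred (fun v => R (a v) (b v) (c v)) :=
  h.subst (t := ![a, b, c]) (by intro i; fin_cases i <;> assumption)

theorem DefPred.subst₄ {R : M → M → M → M → Prop}
    (h : DefPred (fun v : Fin 4 → M => R (v 0) (v 1) (v 2) (v 3)))
    {a b c d : (α → M) → M} [ha : DefFun a] [hb : DefFun b] [hc : DefFun c] [hd : DefFun d] :
    DefPred (fun v => R (a v) (b v) (c v) (d v)) :=
  h.subst (t := ![a, b, c, d]) (by intro i; fin_cases i <;> assumption)

instance DefPred.eq {a b : (α → M) → M} [DefFun a] [DefFun b] :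
    DefPred (fun v => a v = b v) :=
  DefPred.subst₂ (R := (· = ·)) ⟨Empty, inferInstance, Empty.elim,
    Term.equal (Term.var (Sum.inr 0)) (Term.var (Sum.inr 1)), fun v => by simp⟩

instance DefPred.mem {a b : (α → M) → M} [DefFun a] [DefFun b] :
    DefPred (fun v => Mem (a v) (b v)) :=
  DefPred.subst₂ (R := Mem) ⟨Empty, inferInstance, Empty.elim,
    Relations.formula₂ (L := lang) (RelSym.mem : lang.Relations 2)
      (Term.var (Sum.inr 0)) (Term.var (Sum.inr 1)),
    fun _ => Formula.realize_rel₂.trans Iff.rfl⟩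

instance DefPred.ur {a : (α → M) → M} [DefFun a] : DefPred (fun v => Ur (a v)) :=
  DefPred.subst₁ (R := Ur) ⟨Empty, inferInstance, Empty.elim,
    Relations.formula₁ (L := lang) (RelSym.ur : lang.Relations 1) (Term.var (Sum.inr ())),
    fun _ => Formula.realize_rel₁.trans Iff.rfl⟩

instance DefPred.existsUnique {P : (α → M) → M → Prop}
    [h : DefPred (fun v : Option α → M => P (fun i => v (some i)) (v none))] :
    DefPred (fun v => ∃! x, P v x) := by
  -- Two copies of `P` over the same two bound variables: `some none` is the witness `x`, `none` is
  -- its competitor `y`.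
  have h₁ : DefPred (fun v : Option (Option α) → M =>
      P (fun i => v (some (some i))) (v (some none))) :=
    h.comap some
  have h₂ : DefPred (fun v : Option (Option α) → M =>
      P (fun i => v (some (some i))) (v none)) :=
    h.comap (fun i : Option α => i.elim none (fun j => some (some j)))
  have : DefPred (fun v : α → M => ∃ x, P v x ∧ ∀ y, P v y → y = x) := inferInstance
  exact this

/-- Functions that are determined by a definable graph are definable. -/
theorem DefFun.of_graph {f : (α → M) → M} {R : (α → M) → M → Prop}
    (h : ∀ v y, y = f v ↔ R v y)
    [hR : DefPred (fun v : Option α → M => R (fun i => v (some i)) (v none))] : DefFun f :=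
  ⟨hR.congr fun _ => (h _ _).symm⟩

theorem DefFun.subst [Finite β] {f : (β → M) → M} (h : DefFun f) {t : β → (α → M) → M}
    (ht : ∀ i, DefFun (t i)) : DefFun (fun v => f (fun i => t i v)) := by
  refine ⟨?_⟩
  refine h.graph.subst (t := fun i : Option β =>
    i.elim (fun v => v none) (fun j v => t j (fun i => v (some i)))) ?_
  rintro (_ | j)
  · exact DefFun.var none
  · exact ⟨(ht j).graph.comap (fun i : Option α => i.elim none (fun k => some (some k)))⟩

theorem DefFun.subst₁ {f : M → M} (h : DefFun (fun v : Unit → M => f (v ())))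
    {a : (α → M) → M} [ha : DefFun a] : DefFun (fun v => f (a v)) :=
  h.subst (t := fun _ => a) fun _ => ha

theorem DefFun.subst₂ {f : M → M → M} (h : DefFun (fun v : Fin 2 → M => f (v 0) (v 1)))
    {a b : (α → M) → M} [ha : DefFun a] [hb : DefFun b] : DefFun (fun v => f (a v) (b v)) :=
  h.subst (t := ![a, b]) (by intro i; fin_cases i <;> assumption)

theorem DefFun.subst₃ {f : M → M → M → M}
    (h : DefFun (fun v : Fin 3 → M => f (v 0) (v 1) (v 2)))
    {a b c : (α → M) → M} [ha : DefFun a] [hb : DefFun b] [hc : DefFun c] :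
    DefFun (fun v => f (a v) (b v) (c v)) :=
  h.subst (t := ![a, b, c]) (by intro i; fin_cases i <;> assumption)

section Basic

variable {a b c d : (α → M) → M} [DefFun a] [DefFun b] [DefFun c] [DefFun d]

instance : DefPred (fun v => IsSet (a v)) := DefPred.not (P := fun v => Ur (a v))

instance : DefPred (fun v => Sub (a v) (b v)) :=
  DefPred.subst₂ (by unfold Sub; infer_instance)

instance : DefPred (fun v => IsTransSet (a v)) :=
  DefPred.subst₁ (by unfold IsTransSet; infer_instance)

instance : DefPred (fun v => InTC (a v) (b v)) :=
  DefPred.subst₂ (by unfold InTC; infer_instance)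

instance : DefPred (fun v => IsPure (a v)) :=
  DefPred.subst₁ (by unfold IsPure; infer_instance)

instance : DefPred (fun v => IsUPair (a v) (b v) (c v)) :=
  DefPred.subst₃ (by unfold IsUPair; infer_instance)

instance : DefPred (fun v => IsOPair (a v) (b v) (c v)) :=
  DefPred.subst₃ (by unfold IsOPair; infer_instance)

instance : DefPred (fun v => App (a v) (b v) (c v)) :=
  DefPred.subst₃ (by unfold App; infer_instance)

instance : DefPred (fun v => IsFunOn (a v) (b v)) :=
  DefPred.subst₂ (by unfold IsFunOn; infer_instance)

instance : DefPred (fun v => IsOrdinal (a v)) :=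
  DefPred.subst₁ (by unfold IsOrdinal; infer_instance)

instance : DefPred (fun v => Act (a v) (b v) (c v) (d v)) :=
  DefPred.subst₄ (by unfold Act; infer_instance)

instance : DefPred (fun v => IsSym (a v) (b v) (c v) (d v)) :=
  DefPred.subst₄ (by unfold IsSym; infer_instance)

instance : DefPred (fun v => IsSymmetric (a v) (b v) (c v) (d v)) :=
  DefPred.subst₄ (by unfold IsSymmetric; infer_instance)

instance : DefPred (fun v => d v ∈ permModel (a v) (b v) (c v)) :=
  DefPred.subst₄ (R := fun A G F x => x ∈ permModel A G F)
    (inferInstanceAs (DefPred fun v : Fin 4 → M => IsSymmetric (v 0) (v 1) (v 2) (v 3) ∧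
      ∀ y, InTC y (v 3) → IsSymmetric (v 0) (v 1) (v 2) y))

end Basic

end Definability

/-! ### Sets, pairs, functions and ω from the axioms -/

section Sets

variable {M : Type*} [lang.Structure M] {α β : Type}

/-- The class `P` is a set. -/
def Small (P : M → Prop) : Prop := ∃ v, IsSet v ∧ ∀ y, Mem y v ↔ P y

theorem Small.congr {P Q : M → Prop} (h : Small P) (hPQ : ∀ y, P y ↔ Q y) : Small Q := by
  obtain ⟨v, hv, hm⟩ := h
  exact ⟨v, hv, fun y => (hm y).trans (hPQ y)⟩

/-- The set of all elements of a small class. -/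
noncomputable def ofSmall {P : M → Prop} (h : Small P) : M := h.choose

theorem isSet_ofSmall {P : M → Prop} (h : Small P) : IsSet (ofSmall h) := h.choose_spec.1

theorem mem_ofSmall {P : M → Prop} (h : Small P) {y : M} : Mem y (ofSmall h) ↔ P y := h.choose_spec.2 y

theorem DefPred.exists_fin {α : Type} {P : (α → M) → Prop} (h : DefPred P) :
    ∃ (n : ℕ) (p : Fin n → M) (φ : lang.Formula (Fin n ⊕ α)),
      ∀ v, φ.Realize (Sum.elim p v) ↔ P v := by
  obtain ⟨ι, hι, p, φ, hφ⟩ := h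
  obtain ⟨n, ⟨e⟩⟩ := Finite.exists_equiv_fin ι
  refine ⟨n, p ∘ e.symm, φ.relabel (Sum.map e id), fun v => ?_⟩
  rw [Formula.realize_relabel, ← hφ, Sum.elim_comp_map]
  simp [Function.comp_assoc]

theorem DefPred.exists_formula₂ {R : M → M → Prop}
    (h : DefPred (fun v : Fin 2 → M => R (v 0) (v 1))) :
    ∃ (n : ℕ) (p : Fin n → M) (φ : lang.Formula (Fin (n + 2))),
      ∀ x y, φ.Realize (Matrix.vecCons x (Matrix.vecCons y p)) ↔ R x y := by
  obtain ⟨n, p, φ, hφ⟩ := h.exists_fin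
  refine ⟨n, p, φ.relabel (Sum.elim (fun i => i.succ.succ) ![0, 1]), fun x y => ?_⟩
  rw [Formula.realize_relabel]
  refine (iff_of_eq (congrArg _ (funext fun i => ?_))).trans (hφ ![x, y])
  rcases i with i | i
  · rfl
  · fin_cases i <;> rfl

variable [hM : Fact (ZFUR M)]

theorem Mem.isSet {x y : M} (h : Mem x y) : IsSet y := fun hy => hM.out.ur_no_mem y x hy h

theorem ext {x y : M} (hx : IsSet x) (hy : IsSet y) (h : ∀ z, Mem z x ↔ Mem z y) : x = y :=
  hM.out.extensionality x y hx hy h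

/-- A set-valued function is definable if membership in its values is. -/
theorem DefFun.of_mem {f : (α → M) → M} {Q : (α → M) → M → Prop} (hs : ∀ v, IsSet (f v))
    (h : ∀ v y, Mem y (f v) ↔ Q v y)
    [hQ : DefPred (fun v : Option α → M => Q (fun i => v (some i)) (v none))] : DefFun f := by
  have h₂ : DefPred (fun v : Option (Option α) → M =>
      Q (fun i => v (some (some i))) (v none)) :=
    hQ.comap (fun i : Option α => i.elim none (fun j => some (some j)))
  refine DefFun.of_graph (R := fun v x => IsSet x ∧ ∀ y, Mem y x ↔ Q v y) fun v y => ?_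
  constructor
  · rintro rfl
    exact ⟨hs v, h v⟩
  · rintro ⟨hx, hm⟩
    exact ext hx (hs v) fun z => (hm z).trans (h v z).symm

theorem exists_empty : ∃ e : M, IsSet e ∧ ∀ z, ¬ Mem z e := by
  obtain ⟨s, -, ⟨e, -, he⟩, -⟩ := hM.out.infinity
  exact ⟨e, he⟩

theorem small_false : Small (fun _ : M => False) := by
  obtain ⟨e, he, h⟩ := exists_empty (M := M)
  exact ⟨e, he, fun y => ⟨h y, False.elim⟩⟩

/-- A urelement has the same members as the empty set. This frees the later constructions from the
hypothesis that their arguments are sets. -/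
theorem small_mem (x : M) : Small (fun y => Mem y x) := by
  by_cases hx : IsSet x
  · exact ⟨x, hx, fun _ => Iff.rfl⟩
  · exact small_false.congr fun y => ⟨False.elim, fun h => hx h.isSet⟩

theorem small_sep (x : M) (P : M → Prop) [h : DefPred (fun v : Unit → M => P (v ()))] :
    Small (fun y => Mem y x ∧ P y) := by
  obtain ⟨x', hx', hx'm⟩ := small_mem x
  obtain ⟨n, p, φ, hφ⟩ := h.exists_fin
  obtain ⟨v, hv, hm⟩ := hM.out.separation n
    (φ.relabel (Sum.elim Fin.succ (fun _ => 0))) p x' hx'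
  refine ⟨v, hv, fun y => (hm y).trans (and_congr (hx'm y) ?_)⟩
  rw [Formula.realize_relabel]
  refine (iff_of_eq (congrArg _ (funext fun i => ?_))).trans (hφ (fun _ => y))
  rcases i with i | i <;> rfl

theorem Small.of_subset {P Q : M → Prop} (h : Small Q) (hPQ : ∀ y, P y → Q y)
    [DefPred (fun v : Unit → M => P (v ()))] : Small P :=
  (small_sep (ofSmall h) P).congr fun y => by
    rw [mem_ofSmall h]
    exact ⟨fun h => h.2, fun h => ⟨hPQ y h, h⟩⟩

theorem small_replace (w : M) (R : M → M → Prop) (hR : ∀ x, Mem x w → ∃! y, R x y)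
    [h : DefPred (fun v : Fin 2 → M => R (v 0) (v 1))] :
    Small (fun y => ∃ x, Mem x w ∧ R x y) := by
  obtain ⟨w', hw', hw'm⟩ := small_mem w
  obtain ⟨n, p, φ, hφ⟩ := DefPred.exists_formula₂ h
  obtain ⟨v, hv, hm⟩ := hM.out.replacement n φ p w' hw' fun x hx =>
    (existsUnique_congr (hφ x)).2 (hR x ((hw'm x).1 hx))
  refine ⟨v, hv, fun y => (hm y).trans (exists_congr fun x => and_congr (hw'm x) (hφ x y))⟩

/-- The collection principle for definable relations. -/
theorem Collection.exists (hc : Collection M) (w : M) (R : M → M → Prop)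
    (hR : ∀ x, Mem x w → ∃ y, R x y) [h : DefPred (fun v : Fin 2 → M => R (v 0) (v 1))] :
    ∃ v, ∀ x, Mem x w → ∃ y, Mem y v ∧ R x y := by
  obtain ⟨w', hw', hw'm⟩ := small_mem w
  obtain ⟨n, p, φ, hφ⟩ := DefPred.exists_formula₂ h
  obtain ⟨v, -, hm⟩ := hc n φ p w' hw' fun x hx =>
    (exists_congr (hφ x)).2 (hR x ((hw'm x).1 hx))
  refine ⟨v, fun x hx => ?_⟩
  obtain ⟨y, hy, h⟩ := hm x ((hw'm x).2 hx)
  exact ⟨y, hy, (hφ x y).1 h⟩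

/-- Separation first cuts `w` down to the points where `R` has a value; Replacement, which demands
totality, then applies. -/
theorem small_partial_image (w : M) (R : M → M → Prop)
    (hR : ∀ x y z, Mem x w → R x y → R x z → y = z)
    [h : DefPred (fun v : Fin 2 → M => R (v 0) (v 1))] :
    Small (fun y => ∃ x, Mem x w ∧ R x y) := by
  have hd : DefPred (fun v : Unit → M => ∃ y, R (v ()) y) := by
    have : DefPred (fun v : Option Unit → M => R (v (some ())) (v none)) :=
      DefPred.subst₂ (a := fun v => v (some ())) (b := fun v => v none) h
    infer_instance
  have hs := small_sep w (fun x => ∃ y, R x y)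
  refine (small_replace (ofSmall hs) R fun x hx => ?_).congr fun y => ?_
  · obtain ⟨hx, y, hy⟩ := (mem_ofSmall hs).1 hx
    exact ⟨y, hy, fun z hz => hR x z y hx hz hy⟩
  · exact exists_congr fun x => ⟨fun h => ⟨((mem_ofSmall hs).1 h.1).1, h.2⟩,
      fun h => ⟨(mem_ofSmall hs).2 ⟨h.1, y, h.2⟩, h.2⟩⟩

theorem small_image (w : M) (F : M → M) [h : DefFun (fun v : Unit → M => F (v ()))] :
    Small (fun y => ∃ x, Mem x w ∧ y = F x) :=
  have : DefFun (fun v : Fin 2 → M => F (v 0)) := DefFun.subst₁ (a := fun v => v 0) h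
  small_partial_image w (fun x y => y = F x) fun _ _ _ _ hy hz => hy.trans hz.symm

theorem small_sUnion (x : M) : Small (fun z => ∃ y, Mem y x ∧ Mem z y) := by
  obtain ⟨x', hx', hx'm⟩ := small_mem x
  obtain ⟨u, hu, hm⟩ := hM.out.union x' hx'
  exact ⟨u, hu, fun z => (hm z).trans (exists_congr fun y => and_congr_left fun _ => hx'm y)⟩

theorem small_powerset (x : M) : Small (fun y => IsSet y ∧ Sub y x) := by
  obtain ⟨x', hx', hx'm⟩ := small_mem x
  obtain ⟨p, hp, hm⟩ := hM.out.powerset x' hx'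
  exact ⟨p, hp, fun z => (hm z).trans (and_congr_right fun _ =>
    forall_congr' fun y => imp_congr_right fun _ => hx'm y)⟩

theorem small_upair (x y : M) : Small (fun z => z = x ∨ z = y) := hM.out.pairing x y

theorem small_biUnion (w : M) (F : M → M) [h : DefFun (fun v : Unit → M => F (v ()))] :
    Small (fun z => ∃ x, Mem x w ∧ Mem z (F x)) :=
  (small_sUnion (ofSmall (small_image w F))).congr fun z => by
    constructor
    · rintro ⟨y, hy, hz⟩
      obtain ⟨x, hx, rfl⟩ := (mem_ofSmall _).1 hy
      exact ⟨x, hx, hz⟩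
    · rintro ⟨x, hx, hz⟩
      exact ⟨F x, (mem_ofSmall _).2 ⟨x, hx, rfl⟩, hz⟩

/-- The unordered pair. -/
noncomputable def upair (x y : M) : M := ofSmall (small_upair x y)

@[simp]
theorem mem_upair {x y z : M} : Mem z (upair x y) ↔ z = x ∨ z = y := mem_ofSmall _

@[simp]
theorem isSet_upair (x y : M) : IsSet (upair x y) := isSet_ofSmall _

instance {a b : (α → M) → M} [DefFun a] [DefFun b] : DefFun (fun v => upair (a v) (b v)) :=
  DefFun.subst₂ (DefFun.of_mem (fun _ => isSet_upair _ _) fun _ _ => mem_upair)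

theorem Small.or {P Q : M → Prop} (hP : Small P) (hQ : Small Q) : Small (fun z => P z ∨ Q z) :=
  (small_sUnion (upair (ofSmall hP) (ofSmall hQ))).congr fun z => by
    simp [or_and_right, exists_or, mem_ofSmall]

theorem isUPair_iff {p x y : M} : IsUPair p x y ↔ p = upair x y := by
  constructor
  · intro h
    exact ext (((h x).2 (Or.inl rfl)).isSet) (isSet_upair _ _) fun z => (h z).trans mem_upair.symm
  · rintro rfl z
    exact mem_upair

theorem upair_self_inj {x y z : M} (h : upair x x = upair y z) : x = y ∧ x = z := by
  have h₁ : Mem y (upair x x) := by simp [h]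
  have h₂ : Mem z (upair x x) := by simp [h]
  simp only [mem_upair, or_self] at h₁ h₂
  exact ⟨h₁.symm, h₂.symm⟩

theorem upair_right_inj {x y z : M} (h : upair x y = upair x z) : y = z := by
  have h₁ : Mem y (upair x z) := by simp [← h]
  have h₂ : Mem z (upair x y) := by simp [h]
  simp only [mem_upair] at h₁ h₂
  rcases h₁ with rfl | h₁
  · rcases h₂ with h₂ | h₂ <;> exact h₂.symm
  · exact h₁

/-- The Kuratowski ordered pair. -/
noncomputable def opair (x y : M) : M := upair (upair x x) (upair x y)

instance {a b : (α → M) → M} [DefFun a] [DefFun b] : DefFun (fun v => opair (a v) (b v)) :=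
  inferInstanceAs (DefFun fun v => upair (upair (a v) (a v)) (upair (a v) (b v)))

theorem isOPair_iff {p x y : M} : IsOPair p x y ↔ p = opair x y := by
  simp [IsOPair, isUPair_iff, opair]

theorem opair_inj {x y x' y' : M} : opair x y = opair x' y' ↔ x = x' ∧ y = y' := by
  constructor
  · intro h
    have hx : x = x' := by
      have : Mem (upair x x) (opair x' y') := h ▸ by simp [opair]
      simp only [opair, mem_upair] at this
      rcases this with h | h <;> exact (upair_self_inj h).1
    subst hx
    exact ⟨rfl, upair_right_inj (upair_right_inj h)⟩
  · rintro ⟨rfl, rfl⟩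
    rfl

theorem app_iff {f x y : M} : App f x y ↔ Mem (opair x y) f := by
  simp [App, isOPair_iff]

/-- Definable functions on sets are sets. -/
theorem exists_funOn (d : M) (R : M → M → Prop) (hR : ∀ x, Mem x d → ∃! y, R x y)
    [h : DefPred (fun v : Fin 2 → M => R (v 0) (v 1))] :
    ∃ f, IsFunOn f d ∧ (∀ x y, App f x y ↔ Mem x d ∧ R x y) := by
  have h' : ∀ {α : Type} (a b : (α → M) → M) [DefFun a] [DefFun b],
      DefPred (fun v => R (a v) (b v)) := fun a b _ _ => DefPred.subst₂ h
  have hs : Small (fun z => ∃ x, Mem x d ∧ ∃ y, R x y ∧ z = opair x y) := by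
    refine small_partial_image d (fun x z => ∃ y, R x y ∧ z = opair x y) ?_
    rintro x _ _ hx ⟨y, hy, rfl⟩ ⟨y', hy', rfl⟩
    rw [(hR x hx).unique hy hy']
  have happ : ∀ x y, App (ofSmall hs) x y ↔ Mem x d ∧ R x y := by
    intro x y
    rw [app_iff, mem_ofSmall]
    constructor
    · rintro ⟨x', hx', y', hy', h⟩
      obtain ⟨rfl, rfl⟩ := opair_inj.1 h
      exact ⟨hx', hy'⟩
    · rintro ⟨hx, hy⟩
      exact ⟨x, hx, y, hy, rfl⟩
  refine ⟨ofSmall hs, ⟨isSet_ofSmall _, fun p hp => ?_, fun x hx => ?_⟩, happ⟩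
  · obtain ⟨x, hx, y, hy, rfl⟩ := (mem_ofSmall _).1 hp
    exact ⟨x, y, hx, isOPair_iff.2 rfl⟩
  · obtain ⟨y, hy, hu⟩ := hR x hx
    exact ⟨y, (happ x y).2 ⟨hx, hy⟩, fun z hz => hu z ((happ x z).1 hz).2⟩

theorem IsFunOn.mem_dom {f d x y : M} (hf : IsFunOn f d) (h : App f x y) : Mem x d := by
  obtain ⟨p, hp, hpf⟩ := h
  obtain ⟨x', y', hx', hp'⟩ := hf.2.1 p hpf
  rw [isOPair_iff] at hp hp'
  rw [hp, opair_inj] at hp'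
  exact hp'.1 ▸ hx'

theorem IsFunOn.unique {f d x y z : M} (hf : IsFunOn f d) (h : App f x y) (h' : App f x z) :
    y = z :=
  (hf.2.2 x (hf.mem_dom h)).unique h h'

theorem not_mem_self (x : M) : ¬ Mem x x := by
  intro h
  obtain ⟨y, hy, hm⟩ := hM.out.foundation (upair x x) ⟨x, by simp⟩
  simp only [mem_upair, or_self] at hy hm
  subst hy
  exact hm _ h rfl

theorem Mem.asymm {x y : M} (h : Mem x y) : ¬ Mem y x := by
  intro h'
  obtain ⟨z, hz, hm⟩ := hM.out.foundation (upair x y) ⟨x, by simp⟩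
  simp only [mem_upair] at hz hm
  rcases hz with rfl | rfl
  · exact hm _ h' (Or.inr rfl)
  · exact hm _ h (Or.inl rfl)

/-- The empty set. -/
noncomputable def empty (M : Type*) [lang.Structure M] [Fact (ZFUR M)] : M :=
  ofSmall (small_false (M := M))

@[simp]
theorem not_mem_empty (x : M) : ¬ Mem x (empty M) := fun h => (mem_ofSmall _).1 h

theorem isSet_empty : IsSet (empty M) := isSet_ofSmall _

theorem small_insert (x y : M) : Small (fun z => z = x ∨ Mem z y) :=
  ((small_upair x x).congr fun _ => or_self_iff).or (small_mem y)

/-- `insert x y = {x} ∪ y`. -/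
noncomputable def insert (x y : M) : M := ofSmall (small_insert x y)

@[simp]
theorem mem_insert {x y z : M} : Mem z (insert x y) ↔ z = x ∨ Mem z y := mem_ofSmall _

@[simp]
theorem isSet_insert (x y : M) : IsSet (insert x y) := isSet_ofSmall _

instance {a b : (α → M) → M} [DefFun a] [DefFun b] : DefFun (fun v => insert (a v) (b v)) :=
  DefFun.subst₂ (DefFun.of_mem (fun _ => isSet_insert _ _) fun _ _ => mem_insert)

theorem insert_self_ne_empty (x : M) : insert x x ≠ empty M := fun h =>
  not_mem_empty x (h ▸ mem_insert.2 (Or.inl rfl))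

theorem insert_self_inj {x y : M} (h : insert x x = insert y y) : x = y := by
  have h₁ : Mem x (insert y y) := h ▸ mem_insert.2 (Or.inl rfl)
  have h₂ : Mem y (insert x x) := h ▸ mem_insert.2 (Or.inl rfl)
  rw [mem_insert] at h₁ h₂
  rcases h₁ with h₁ | h₁
  · exact h₁
  · rcases h₂ with h₂ | h₂
    · exact h₂.symm
    · exact (h₁.asymm h₂).elim

/-- `s` contains the empty set and is closed under successors. -/
def IsInductive (s : M) : Prop := Mem (empty M) s ∧ ∀ x, Mem x s → Mem (insert x x) s

instance {a : (α → M) → M} [DefFun a] : DefPred (fun v => IsInductive (a v)) :=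
  DefPred.subst₁ (by unfold IsInductive; infer_instance)

theorem exists_isInductive : ∃ s : M, IsInductive s := by
  obtain ⟨s, -, ⟨e, he, hes, hee⟩, hs⟩ := hM.out.infinity
  refine ⟨s, ?_, fun x hx => ?_⟩
  · rwa [← ext hes isSet_empty fun z => iff_of_false (hee z) (not_mem_empty z)]
  · obtain ⟨y, hy, hm⟩ := hs x hx
    rwa [← ext ((hm x).2 (Or.inr rfl)).isSet (isSet_insert x x)
      fun z => (hm z).trans (or_comm.trans mem_insert.symm)]

theorem small_omega : Small (fun n : M => ∀ s, IsInductive s → Mem n s) := by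
  obtain ⟨s, hs⟩ := exists_isInductive (M := M)
  exact (small_mem s).of_subset fun n hn => hn s hs

/-- The set of natural numbers. -/
noncomputable def omega (M : Type*) [lang.Structure M] [Fact (ZFUR M)] : M :=
  ofSmall (small_omega (M := M))

theorem isInductive_omega : IsInductive (omega M) :=
  ⟨(mem_ofSmall _).2 fun _ hs => hs.1, fun _ hx => (mem_ofSmall _).2 fun s hs =>
    hs.2 _ ((mem_ofSmall _).1 hx s hs)⟩

theorem omega_induction {P : M → Prop} [DefPred (fun v : Unit → M => P (v ()))]
    (h0 : P (empty M)) (hs : ∀ n, Mem n (omega M) → P n → P (insert n n)) {n : M}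
    (hn : Mem n (omega M)) : P n := by
  have h := small_sep (omega M) P
  have hi : IsInductive (ofSmall h) := ⟨(mem_ofSmall h).2 ⟨isInductive_omega.1, h0⟩, fun x hx =>
    have hx := (mem_ofSmall h).1 hx
    (mem_ofSmall h).2 ⟨isInductive_omega.2 x hx.1, hs x hx.1 hx.2⟩⟩
  exact ((mem_ofSmall h).1 ((mem_ofSmall _).1 hn _ hi)).2

end Sets

/-! ### Transitive closures and ∈-recursion, for both the group action and the collapse of ordinals
-/

section Recursion

variable {M : Type*} [lang.Structure M] {α β : Type}

theorem InTC.of_mem {x y : M} (h : Mem y x) : InTC y x := fun _ _ hx => hx y h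

theorem InTC.of_mem_of_inTC {x y z : M} (hz : InTC z y) (hy : Mem y x) : InTC z x :=
  fun t ht hx => hz t ht (ht.2 y (hx y hy))

theorem InTC.of_inTC_of_mem {x y z : M} (hy : InTC y x) (hz : Mem z y) : InTC z x :=
  fun t ht hx => ht.2 y (hy t ht hx) z hz

theorem inTC_of_isTransSet {t y : M} (ht : IsTransSet t) : InTC y t ↔ Mem y t :=
  ⟨fun h => h t ht fun _ => id, InTC.of_mem⟩

/-- The function `f` on the transitive set `t` satisfies the recursion clauses
`f a = b` with `B a b` for urelements `a` and `f x = {f y : y ∈ x, Q y}` for sets `x`. -/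
def IsRec (B : M → M → Prop) (Q : M → Prop) (t f : M) : Prop :=
  IsTransSet t ∧ IsFunOn f t ∧ ∀ z w, App f z w → (Ur z → B z w) ∧
    (IsSet z → IsSet w ∧ ∀ u, Mem u w ↔ ∃ v, Mem v z ∧ Q v ∧ App f v u)

/-- The function defined by recursion along membership maps `x` to `y`. -/
def RecVal (B : M → M → Prop) (Q : M → Prop) (x y : M) : Prop :=
  ∃ t f, IsRec B Q t f ∧ App f x y

variable {B : M → M → Prop} {Q : M → Prop}

theorem RecVal.ur {x y : M} (h : RecVal B Q x y) (hx : Ur x) : B x y := by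
  obtain ⟨t, f, hf, h⟩ := h
  exact (hf.2.2 x y h).1 hx

theorem DefPred.recVal [hB : DefPred (fun v : Fin 2 → M => B (v 0) (v 1))]
    [hQ : DefPred (fun v : Unit → M => Q (v ()))] {a b : (α → M) → M} [DefFun a] [DefFun b] :
    DefPred (fun v => RecVal B Q (a v) (b v)) := by
  have hB' : ∀ {α : Type} (a b : (α → M) → M) [DefFun a] [DefFun b],
      DefPred (fun v => B (a v) (b v)) := fun a b _ _ => DefPred.subst₂ hB
  have hQ' : ∀ {α : Type} (a : (α → M) → M) [DefFun a],
      DefPred (fun v => Q (a v)) := fun a _ => DefPred.subst₁ hQ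
  refine DefPred.subst₂ ?_
  unfold RecVal IsRec
  infer_instance

variable [hM : Fact (ZFUR M)]

theorem RecVal.exists_of_inTC {x y z : M} (h : RecVal B Q x y) (hz : InTC z x) :
    ∃ w, RecVal B Q z w := by
  obtain ⟨t, f, hf, h⟩ := h
  have hx := hf.1.2 x (hf.2.1.mem_dom h)
  obtain ⟨w, hw, -⟩ := hf.2.1.2.2 z (hz t hf.1 hx)
  exact ⟨w, t, f, hf, hw⟩

/-- Every object belongs to a set that is closed under a given definable function. -/
theorem exists_closed (F : M → M) [hF : DefFun (fun v : Unit → M => F (v ()))] (x₀ : M) :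
    ∃ S, Mem x₀ S ∧ ∀ x, Mem x S → Mem (F x) S := by
  have hF' : ∀ {α : Type} (t : (α → M) → M) [DefFun t], DefFun (fun v => F (t v)) :=
    fun t _ => DefFun.subst₁ hF
  let Good : M → Prop := fun f => ∀ n y, App f n y →
    n = empty M ∧ y = x₀ ∨ ∃ m z, n = insert m m ∧ y = F z ∧ App f m z
  let It : M → M → Prop := fun n y => ∃ f, Good f ∧ App f n y
  have hu : ∀ n, Mem n (omega M) → ∀ y z, It n y → It n z → y = z := by
    intro n hn
    refine omega_induction (P := fun n => ∀ y z, It n y → It n z → y = z) ?_ ?_ hn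
    · rintro y z ⟨f, hf, hy⟩ ⟨g, hg, hz⟩
      rcases hf _ _ hy with ⟨-, rfl⟩ | ⟨m, w, hm, -⟩
      · rcases hg _ _ hz with ⟨-, rfl⟩ | ⟨m, w, hm, -⟩
        · rfl
        · exact (insert_self_ne_empty m hm.symm).elim
      · exact (insert_self_ne_empty m hm.symm).elim
    · rintro n - ih y z ⟨f, hf, hy⟩ ⟨g, hg, hz⟩
      rcases hf _ _ hy with ⟨h, -⟩ | ⟨m, w, hm, rfl, hw⟩
      · exact (insert_self_ne_empty n h).elim
      · rcases hg _ _ hz with ⟨h, -⟩ | ⟨m', w', hm', rfl, hw'⟩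
        · exact (insert_self_ne_empty n h).elim
        · obtain rfl := insert_self_inj hm
          obtain rfl := insert_self_inj hm'
          rw [ih w w' ⟨f, hf, hw⟩ ⟨g, hg, hw'⟩]
  have h0 : It (empty M) x₀ := by
    refine ⟨upair (opair (empty M) x₀) (opair (empty M) x₀), fun n y h => Or.inl ?_, ?_⟩
    · simpa [app_iff, opair_inj] using h
    · simp [app_iff]
  have hs : ∀ n y, It n y → It (insert n n) (F y) := by
    rintro n y ⟨f, hf, hy⟩
    refine ⟨insert (opair (insert n n) (F y)) f, fun m z h => ?_, ?_⟩
    · simp only [app_iff, mem_insert, opair_inj] at h ⊢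
      rcases h with ⟨rfl, rfl⟩ | h
      · exact Or.inr ⟨n, y, rfl, rfl, Or.inr (app_iff.1 hy)⟩
      · rcases hf m z (app_iff.2 h) with h | ⟨m', z', h₁, h₂, h₃⟩
        · exact Or.inl h
        · exact Or.inr ⟨m', z', h₁, h₂, Or.inr (app_iff.1 h₃)⟩
    · simp [app_iff]
  have hS := small_partial_image (omega M) It fun n y z hn => hu n hn y z
  refine ⟨ofSmall hS, (mem_ofSmall _).2 ⟨_, isInductive_omega.1, h0⟩, fun x hx => ?_⟩
  obtain ⟨n, hn, h⟩ := (mem_ofSmall _).1 hx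
  exact (mem_ofSmall _).2 ⟨_, isInductive_omega.2 n hn, hs n x h⟩

/-- Every object is included in a transitive set. -/
theorem exists_transSet_sub (x : M) : ∃ t, IsTransSet t ∧ Sub x t := by
  have hd : DefFun (fun v : Unit → M => ofSmall (small_sUnion (v ()))) :=
    DefFun.of_mem (fun _ => isSet_ofSmall _) fun _ _ => mem_ofSmall _
  obtain ⟨S, hx, hS⟩ := exists_closed (fun x : M => ofSmall (small_sUnion x)) x
  have hU := small_sUnion S
  refine ⟨ofSmall hU, ⟨isSet_ofSmall _, fun y hy z hz => ?_⟩, fun y hy => (mem_ofSmall _).2 ⟨x, hx, hy⟩⟩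
  obtain ⟨w, hw, hyw⟩ := (mem_ofSmall _).1 hy
  exact (mem_ofSmall _).2 ⟨_, hS w hw, (mem_ofSmall _).2 ⟨y, hyw, hz⟩⟩

/-- Every object belongs to a transitive set. -/
theorem exists_transSet_mem (x : M) : ∃ t, IsTransSet t ∧ Mem x t := by
  obtain ⟨t, ht, hx⟩ := exists_transSet_sub (upair x x)
  exact ⟨t, ht, hx x (by simp)⟩

theorem small_inTC (x : M) : Small (fun y => InTC y x) := by
  obtain ⟨t, ht, hx⟩ := exists_transSet_sub x
  exact (small_mem t).of_subset fun y hy => hy t ht hx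

/-- The objects described on the right form a transitive set that includes `x`, so it contains the
transitive closure. -/
theorem inTC_iff {x z : M} : InTC z x ↔ Mem z x ∨ ∃ y, Mem y x ∧ InTC z y := by
  constructor
  · intro h
    obtain ⟨t, ht, hx⟩ := exists_transSet_sub x
    have hs : Small (fun z => Mem z x ∨ ∃ y, Mem y x ∧ InTC z y) :=
      (small_inTC x).of_subset fun z hz =>
        hz.elim InTC.of_mem fun ⟨y, hy, hz⟩ => hz.of_mem_of_inTC hy
    refine (mem_ofSmall hs).1 (h (ofSmall hs) ⟨isSet_ofSmall hs, fun y hy w hw => (mem_ofSmall hs).2 (Or.inr ?_)⟩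
      fun y hy => (mem_ofSmall hs).2 (Or.inl hy))
    rcases (mem_ofSmall hs).1 hy with hy | ⟨u, hu, hy⟩
    · exact ⟨y, hy, InTC.of_mem hw⟩
    · exact ⟨u, hu, hy.of_inTC_of_mem hw⟩
  · rintro (h | ⟨y, hy, h⟩)
    · exact InTC.of_mem h
    · exact h.of_mem_of_inTC hy

/-- The minimum principle for definable classes. -/
theorem exists_minimal {P : M → Prop} [DefPred (fun v : Unit → M => P (v ()))] {x : M}
    (hx : P x) : ∃ y, P y ∧ ∀ z, Mem z y → ¬ P z := by
  obtain ⟨t, ht, hxt⟩ := exists_transSet_mem x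
  have hs := small_sep t P
  obtain ⟨y, hy, hm⟩ := hM.out.foundation (ofSmall hs) ⟨x, (mem_ofSmall hs).2 ⟨hxt, hx⟩⟩
  obtain ⟨hyt, hy⟩ := (mem_ofSmall hs).1 hy
  exact ⟨y, hy, fun z hz hPz => hm z hz ((mem_ofSmall hs).2 ⟨ht.2 y hyt z hz, hPz⟩)⟩

/-- Induction along membership for definable classes. -/
theorem mem_induction {P : M → Prop} [DefPred (fun v : Unit → M => P (v ()))]
    (h : ∀ x, (∀ y, Mem y x → P y) → P x) (x : M) : P x := by
  by_contra hx
  obtain ⟨y, hy, hm⟩ := exists_minimal (P := fun x => ¬ P x) hx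
  exact hy (h y fun z hz => not_not.1 (hm z hz))

variable [hB : DefPred (fun v : Fin 2 → M => B (v 0) (v 1))]
  [hQ : DefPred (fun v : Unit → M => Q (v ()))]

theorem RecVal.unique (hB' : ∀ a b c, Ur a → B a b → B a c → b = c) {x y z : M}
    (hy : RecVal B Q x y) (hz : RecVal B Q x z) : y = z := by
  have := @DefPred.recVal M _
  refine mem_induction (P := fun x => ∀ y z, RecVal B Q x y → RecVal B Q x z → y = z)
    (fun x ih => ?_) x y z hy hz
  rintro y z ⟨t, f, hf, hy⟩ ⟨s, g, hg, hz⟩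
  by_cases hx : IsSet x
  · obtain ⟨hys, hym⟩ := (hf.2.2 x y hy).2 hx
    obtain ⟨hzs, hzm⟩ := (hg.2.2 x z hz).2 hx
    refine ext hys hzs fun u => ?_
    rw [hym, hzm]
    refine exists_congr fun v => and_congr_right fun hv => and_congr_right fun _ => ?_
    obtain ⟨u₁, hu₁, -⟩ := hf.2.1.2.2 v (hf.1.2 x (hf.2.1.mem_dom hy) v hv)
    obtain ⟨u₂, hu₂, -⟩ := hg.2.1.2.2 v (hg.1.2 x (hg.2.1.mem_dom hz) v hv)
    have he := ih v hv u₁ u₂ ⟨t, f, hf, hu₁⟩ ⟨s, g, hg, hu₂⟩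
    constructor
    · intro h
      rwa [hf.2.1.unique h hu₁, he]
    · intro h
      rwa [hg.2.1.unique h hu₂, ← he]
  · exact hB' x y z (not_not.1 hx) ((hf.2.2 x y hy).1 (not_not.1 hx))
      ((hg.2.2 x z hz).1 (not_not.1 hx))

theorem RecVal.mem_iff (hB' : ∀ a b c, Ur a → B a b → B a c → b = c) {x y : M}
    (h : RecVal B Q x y) (hx : IsSet x) :
    IsSet y ∧ ∀ u, Mem u y ↔ ∃ v, Mem v x ∧ Q v ∧ RecVal B Q v u := by
  have h' := h
  obtain ⟨t, f, hf, h⟩ := h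
  obtain ⟨hys, hym⟩ := (hf.2.2 x y h).2 hx
  refine ⟨hys, fun u => (hym u).trans ?_⟩
  refine exists_congr fun v => and_congr_right fun hv => and_congr_right fun _ =>
    ⟨fun h => ⟨t, f, hf, h⟩, fun hu => ?_⟩
  obtain ⟨w, hw, -⟩ := hf.2.1.2.2 v (hf.1.2 x (hf.2.1.mem_dom h) v hv)
  rwa [hu.unique hB' ⟨t, f, hf, hw⟩]

/-- ∈-induction. Values exist on the transitive closure of `x` by the induction hypothesis. The
one-step clause `R` determines the value at `x` and agrees with the recursion below it, so
Replacement turns `R` restricted to `{x} ∪ TC(x)` into a set function satisfying the clauses. -/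
theorem RecVal.existence (hB' : ∀ a, Ur a → ∃! b, B a b) (x : M) : ∃ y, RecVal B Q x y := by
  have hB'' : ∀ a b c, Ur a → B a b → B a c → b = c := fun a b c ha => (hB' a ha).unique
  have := @DefPred.recVal M _
  refine mem_induction (P := fun x => ∃ y, RecVal B Q x y) (fun x ih => ?_) x
  have hex : ∀ z, InTC z x → ∃ w, RecVal B Q z w := by
    intro z hz
    rcases inTC_iff.1 hz with hz | ⟨y, hy, hz⟩
    · exact ih z hz
    · obtain ⟨w, hw⟩ := ih y hy
      exact hw.exists_of_inTC hz
  have hQ' : ∀ {α : Type} (a : (α → M) → M) [DefFun a],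
      DefPred (fun v => Q (a v)) := fun a _ => DefPred.subst₁ hQ
  have hBd : ∀ {α : Type} (a b : (α → M) → M) [DefFun a] [DefFun b],
      DefPred (fun v => B (a v) (b v)) := fun a b _ _ => DefPred.subst₂ hB
  let R : M → M → Prop := fun z w => (Ur z → B z w) ∧
    (IsSet z → IsSet w ∧ ∀ u, Mem u w ↔ ∃ v, Mem v z ∧ Q v ∧ RecVal B Q v u)
  have hR : ∀ z w, RecVal B Q z w → R z w := fun z w h => ⟨h.ur, h.mem_iff hB''⟩
  have hRu : ∀ z w w', R z w → R z w' → w = w' := by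
    intro z w w' h h'
    by_cases hz : IsSet z
    · exact ext (h.2 hz).1 (h'.2 hz).1 fun u => ((h.2 hz).2 u).trans ((h'.2 hz).2 u).symm
    · exact hB'' z w w' (not_not.1 hz) (h.1 (not_not.1 hz)) (h'.1 (not_not.1 hz))
  have hRx : ∃ w, R x w := by
    by_cases hx : IsSet x
    · have hs : Small (fun u => ∃ v, Mem v x ∧ Q v ∧ RecVal B Q v u) :=
        small_partial_image x (fun v u => Q v ∧ RecVal B Q v u)
          fun v u u' _ h h' => h.2.unique hB'' h'.2
      exact ⟨ofSmall hs, fun h => (hx h).elim, fun _ => ⟨isSet_ofSmall hs, fun u => mem_ofSmall hs⟩⟩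
    · obtain ⟨b, hb, -⟩ := hB' x (not_not.1 hx)
      exact ⟨b, fun _ => hb, fun h => (hx h).elim⟩
  have ht : Small (fun z => z = x ∨ InTC z x) :=
    ((small_upair x x).congr fun _ => or_self_iff).or (small_inTC x)
  have htx : ∀ y, Mem y (ofSmall ht) → ∀ z, Mem z y → InTC z x := by
    intro y hy z hz
    rcases (mem_ofSmall ht).1 hy with rfl | hy
    · exact InTC.of_mem hz
    · exact hy.of_inTC_of_mem hz
  have htt : IsTransSet (ofSmall ht) := ⟨isSet_ofSmall ht, fun y hy z hz =>
    (mem_ofSmall ht).2 (Or.inr (htx y hy z hz))⟩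
  obtain ⟨f, hf, hfa⟩ := exists_funOn (ofSmall ht) R fun z hz => by
    rcases (mem_ofSmall ht).1 hz with rfl | hz
    · obtain ⟨w, hw⟩ := hRx
      exact ⟨w, hw, fun w' hw' => hRu _ _ _ hw' hw⟩
    · obtain ⟨w, hw⟩ := hex z hz
      exact ⟨w, hR z w hw, fun w' hw' => hRu _ _ _ hw' (hR z w hw)⟩
  have hxt : Mem x (ofSmall ht) := (mem_ofSmall ht).2 (Or.inl rfl)
  obtain ⟨w, hw⟩ := hRx
  refine ⟨w, ofSmall ht, f, ⟨htt, hf, fun z w hzw => ?_⟩, (hfa x w).2 ⟨hxt, hw⟩⟩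
  obtain ⟨hz, hzw⟩ := (hfa z w).1 hzw
  refine ⟨hzw.1, fun hzs => ⟨(hzw.2 hzs).1, fun u => ((hzw.2 hzs).2 u).trans ?_⟩⟩
  refine exists_congr fun v => and_congr_right fun hv => and_congr_right fun _ => ?_
  have hv' := htx z hz v hv
  rw [hfa]
  refine ⟨fun h => ⟨(mem_ofSmall ht).2 (Or.inr hv'), hR _ _ h⟩, fun h => ?_⟩
  obtain ⟨w', hw'⟩ := hex v hv'
  rwa [hRu _ _ _ h.2 (hR _ _ hw')]

end Recursion

/-! ### The action of the group, supports and hereditary symmetry -/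

section Action

variable {M : Type*} [lang.Structure M] {α β : Type}

open Classical in
/-- The object `π x`. -/
noncomputable def act (A π x : M) : M := if h : ∃! y, Act A π x y then h.choose else x

/-- The default value `x` makes the action a total function whose graph is definable whatever `π`
is, so it may occur as a term in definable conditions. -/
theorem eq_act_iff {A π x y : M} : y = act A π x ↔
    (∃! y, Act A π x y) ∧ Act A π x y ∨ ¬ (∃! y, Act A π x y) ∧ y = x := by
  unfold act
  split_ifs with h
  · simp only [h, not_true_eq_false, false_and, or_false, true_and]
    exact ⟨fun e => e ▸ h.choose_spec.1, h.choose_spec.2 y⟩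
  · simp only [h, not_false_eq_true, false_and, false_or, true_and]

instance {a b c : (α → M) → M} [DefFun a] [DefFun b] [DefFun c] :
    DefFun (fun v => act (a v) (b v) (c v)) :=
  DefFun.subst₃ (DefFun.of_graph fun _ _ => eq_act_iff)

/-- `f` commutes with the formation of sets. -/
structure IsHom (f : M → M) : Prop where
  ur : ∀ x, Ur x → Ur (f x)
  isSet : ∀ x, IsSet x → IsSet (f x)
  mem : ∀ x, IsSet x → ∀ u, Mem u (f x) ↔ ∃ v, Mem v x ∧ u = f v

theorem IsHom.id : IsHom (fun x : M => x) :=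
  ⟨fun _ hx => hx, fun _ hx => hx, fun x _ u => by simp⟩

theorem IsHom.comp {f g : M → M} (hf : IsHom f) (hg : IsHom g) : IsHom (fun x => f (g x)) :=
  ⟨fun x hx => hf.ur _ (hg.ur x hx), fun x hx => hf.isSet _ (hg.isSet x hx), fun x hx u => by
    rw [hf.mem _ (hg.isSet x hx)]
    constructor
    · rintro ⟨v, hv, rfl⟩
      obtain ⟨w, hw, rfl⟩ := (hg.mem x hx v).1 hv
      exact ⟨w, hw, rfl⟩
    · rintro ⟨w, hw, rfl⟩
      exact ⟨g w, (hg.mem x hx _).2 ⟨w, hw, rfl⟩, rfl⟩⟩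

/-- The action of `π` on urelements. -/
def ActUr (A π a b : M) : Prop := (Mem a A → App π a b) ∧ (¬ Mem a A → b = a)

theorem existsUnique_actUr {A π : M} (hπ : IsBij π A A) (a : M) : ∃! b, ActUr A π a b := by
  by_cases ha : Mem a A
  · simpa [ActUr, ha] using hπ.1.2.2 a ha
  · simp [ActUr, ha]

/-- `F` is a normal filter on a group `G` of permutations of a set `A` of urelements. -/
structure NormalSystem (A G F : M) : Prop where
  isUrSet : IsUrSet A
  isPermGroup : IsPermGroup A G
  isNormalFilter : IsNormalFilter A G F

theorem NormalSystem.mem_of_mem {A G F π K : M} (h : NormalSystem A G F) 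
   (hπ : Mem π K) (hK : Mem K F) : Mem π G :=
  (h.isNormalFilter.subgroup K hK).2 π hπ

variable [hM : Fact (ZFUR M)]

/-- By ∈-induction such a map is determined by its values on urelements. All identities between
compositions of group elements are checked this way. -/
theorem IsHom.ext {f g : M → M} (hf : IsHom f) (hg : IsHom g)
    [hfd : DefFun (fun v : Unit → M => f (v ()))] [hgd : DefFun (fun v : Unit → M => g (v ()))]
    (h : ∀ a, Ur a → f a = g a) (x : M) : f x = g x := by
  refine mem_induction (P := fun x => f x = g x) (fun x ih => ?_) x
  by_cases hx : IsSet x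
  · refine UrSet.ext (hf.isSet x hx) (hg.isSet x hx) fun u => ?_
    rw [hf.mem x hx, hg.mem x hx]
    exact exists_congr fun v => and_congr_right fun hv => by rw [ih v hv]
  · exact h x (not_not.1 hx)

theorem IsHom.mem_of_mem {f : M → M} (hf : IsHom f) {x y : M} (h : Mem y x) :
    Mem (f y) (f x) :=
  (hf.mem x h.isSet _).2 ⟨y, h, rfl⟩

theorem act_iff_recVal {A π x y : M} :
    Act A π x y ↔ RecVal (ActUr A π) (fun _ => True) x y := by
  constructor
  · rintro ⟨t, f, ht, hf, h, -, hxy⟩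
    refine ⟨t, f, ⟨ht, hf, fun z w hzw => ?_⟩, hxy⟩
    obtain ⟨h₁, h₂, h₃⟩ := h z w hzw
    simpa using ⟨fun hz => ⟨h₁ hz, h₂ hz⟩, h₃⟩
  · rintro ⟨t, f, ⟨ht, hf, h⟩, hxy⟩
    refine ⟨t, f, ht, hf, fun z w hzw => ?_, hf.mem_dom hxy, hxy⟩
    obtain ⟨h₁, h₂⟩ := h z w hzw
    exact ⟨fun hz => (h₁ hz).1, fun hz => (h₁ hz).2, by simpa using h₂⟩

section

variable {A π : M} (hA : IsUrSet A) (hπ : IsBij π A A)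

include hπ

theorem act_eq_iff {x y : M} : act A π x = y ↔ Act A π x y := by
  have : DefPred (fun v : Fin 2 → M => ActUr A π (v 0) (v 1)) := by
    unfold ActUr
    infer_instance
  have hu : ∃! y, Act A π x y := by
    simp only [act_iff_recVal]
    obtain ⟨y, hy⟩ := RecVal.existence (Q := fun _ => True)
      (fun a _ => existsUnique_actUr hπ a) x
    exact ⟨y, hy, fun z hz =>
      hz.unique (fun a b c _ => (existsUnique_actUr hπ a).unique) hy⟩
  rw [eq_comm, eq_act_iff]
  simp [hu]

theorem app_act {a : M} (ha : Ur a) (haA : Mem a A) : App π a (act A π a) :=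
  ((act_iff_recVal.1 ((act_eq_iff hπ).1 rfl)).ur ha).1 haA

theorem act_of_not_mem {a : M} (ha : Ur a) (haA : ¬ Mem a A) : act A π a = a :=
  ((act_iff_recVal.1 ((act_eq_iff hπ).1 rfl)).ur ha).2 haA

include hA

theorem isHom_act : IsHom (act A π) := by
  have hd : DefPred (fun v : Fin 2 → M => ActUr A π (v 0) (v 1)) := by
    unfold ActUr
    infer_instance
  have h : ∀ x, IsSet x → _ := fun x hx =>
    (act_iff_recVal.1 ((act_eq_iff hπ (x := x)).1 rfl)).mem_iff
      (fun a b c _ => (existsUnique_actUr hπ a).unique) hx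
  refine ⟨fun x hx => ?_, fun x hx => (h x hx).1, fun x hx u => ((h x hx).2 u).trans ?_⟩
  · by_cases hxA : Mem x A
    · exact hA.2 _ (hπ.2.1 _ _ (app_act hπ hx hxA))
    · rwa [act_of_not_mem hπ hx hxA]
  · simp only [← act_iff_recVal, ← act_eq_iff hπ, true_and, eq_comm]

end

section

variable {A K : M} (hA : IsUrSet A) (hK : IsPermGroup A K)

include hA hK

theorem act_eq_of_app {π a b : M} (hπ : Mem π K) (h : App π a b) : act A π a = b :=
  have ha := (hK.perm π hπ).1.mem_dom h
  (hK.perm π hπ).1.unique (app_act (hK.perm π hπ) (hA.2 a ha) ha) h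

theorem act_eq_act_act {π ρ σ : M} (hπ : Mem π K) (hρ : Mem ρ K) (hσ : Mem σ K)
    (h : ∀ a c, App σ a c ↔ ∃ b, App ρ a b ∧ App π b c) (x : M) :
    act A σ x = act A π (act A ρ x) := by
  refine (isHom_act hA (hK.perm σ hσ)).ext
    ((isHom_act hA (hK.perm π hπ)).comp (isHom_act hA (hK.perm ρ hρ))) (fun a ha => ?_) x
  by_cases haA : Mem a A
  · obtain ⟨b, hb, hc⟩ := (h _ _).1 (app_act (hK.perm σ hσ) ha haA)
    rw [act_eq_of_app hA hK hρ hb, act_eq_of_app hA hK hπ hc]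
  · rw [act_of_not_mem (hK.perm σ hσ) ha haA, act_of_not_mem (hK.perm ρ hρ) ha haA,
      act_of_not_mem (hK.perm π hπ) ha haA]

theorem act_eq_self_of_app {ι : M} (hι : Mem ι K) (h : ∀ a, Mem a A → App ι a a) (x : M) :
    act A ι x = x := by
  refine (isHom_act hA (hK.perm ι hι)).ext IsHom.id (fun a ha => ?_) x
  by_cases haA : Mem a A
  · exact act_eq_of_app hA hK hι (h a haA)
  · exact act_of_not_mem (hK.perm ι hι) ha haA

theorem act_act_of_app {π ρ : M} (hπ : Mem π K) (hρ : Mem ρ K)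
    (h : ∀ a b, App ρ a b ↔ App π b a) (x : M) : act A ρ (act A π x) = x := by
  refine ((isHom_act hA (hK.perm ρ hρ)).comp (isHom_act hA (hK.perm π hπ))).ext
    IsHom.id (fun a ha => ?_) x
  by_cases haA : Mem a A
  · exact act_eq_of_app hA hK hρ ((h _ _).2 (app_act (hK.perm π hπ) ha haA))
  · rw [act_of_not_mem (hK.perm π hπ) ha haA, act_of_not_mem (hK.perm ρ hρ) ha haA]

theorem exists_act_inv {π : M} (hπ : Mem π K) : ∃ ρ, Mem ρ K ∧
    (∀ a b, App ρ a b ↔ App π b a) ∧ (∀ x, act A ρ (act A π x) = x) ∧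
    ∀ x, act A π (act A ρ x) = x := by
  obtain ⟨ρ, hρ, h⟩ := hK.inv π hπ
  exact ⟨ρ, hρ, h, act_act_of_app hA hK hπ hρ h,
    act_act_of_app hA hK hρ hπ fun a b => (h b a).symm⟩

/-- A set that is mapped into itself by all elements of a group is fixed by them. -/
theorem act_eq_self_of_forall_mem {x : M} (hx : IsSet x)
    (h : ∀ π, Mem π K → ∀ y, Mem y x → Mem (act A π y) x) {π : M} (hπ : Mem π K) :
    act A π x = x := by
  have hh := isHom_act hA (hK.perm π hπ)
  refine UrSet.ext (hh.isSet x hx) hx fun u => ?_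
  rw [hh.mem x hx]
  constructor
  · rintro ⟨v, hv, rfl⟩
    exact h π hπ v hv
  · intro hu
    obtain ⟨ρ, hρ, -, -, hinv⟩ := exists_act_inv hA hK hπ
    exact ⟨act A ρ u, h ρ hρ u hu, (hinv u).symm⟩

/-- The elements of a group that fix a given object form a group. -/
theorem isPermGroup_stabilizer {x s : M} (hs : IsSet s)
    (hsm : ∀ π, Mem π s ↔ Mem π K ∧ act A π x = x) : IsPermGroup A s where
  isSet := hs
  perm π hπ := hK.perm π ((hsm π).1 hπ).1
  one := by
    obtain ⟨ι, hι, h⟩ := hK.one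
    exact ⟨ι, (hsm ι).2 ⟨hι, act_eq_self_of_app hA hK hι h x⟩, h⟩
  mul π ρ hπ hρ := by
    rw [hsm] at hπ hρ
    obtain ⟨σ, hσ, h⟩ := hK.mul π ρ hπ.1 hρ.1
    refine ⟨σ, (hsm σ).2 ⟨hσ, ?_⟩, h⟩
    rw [act_eq_act_act hA hK hπ.1 hρ.1 hσ h, hρ.2, hπ.2]
  inv π hπ := by
    rw [hsm] at hπ
    obtain ⟨ρ, hρ, h, hinv, -⟩ := exists_act_inv hA hK hπ.1
    refine ⟨ρ, (hsm ρ).2 ⟨hρ, ?_⟩, h⟩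
    conv_lhs => rw [← hπ.2, hinv]

end

theorem mem_permModel_iff {A G F x : M} : x ∈ permModel A G F ↔
    IsSymmetric A G F x ∧ ∀ y, Mem y x → y ∈ permModel A G F := by
  constructor
  · rintro ⟨hx, hy⟩
    exact ⟨hx, fun y hyx => ⟨hy y (InTC.of_mem hyx), fun z hz => hy z (hz.of_mem_of_inTC hyx)⟩⟩
  · rintro ⟨hx, hy⟩
    refine ⟨hx, fun z hz => ?_⟩
    rcases inTC_iff.1 hz with hz | ⟨y, hyx, hz⟩
    · exact (hy z hz).1
    · exact (hy y hyx).2 z hz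

theorem mem_permModel_of_mem {A G F x y : M} (hx : x ∈ permModel A G F) (hy : Mem y x) :
    y ∈ permModel A G F :=
  (mem_permModel_iff.1 hx).2 y hy

namespace NormalSystem

variable {A G F : M} (h : NormalSystem A G F)

include h

theorem isHom {π : M} (hπ : Mem π G) : IsHom (act A π) :=
  isHom_act h.isUrSet (h.isPermGroup.perm π hπ)

/-- The stabilizer of `x` is a group including any support `K`, so closure of the filter under
supergroups applies. Afterwards it suffices to exhibit some support, never the exact stabilizer. -/
theorem isSymmetric_iff {x : M} :
    IsSymmetric A G F x ↔ ∃ K, Mem K F ∧ ∀ π, Mem π K → act A π x = x := by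
  constructor
  · rintro ⟨s, hs, hsF⟩
    refine ⟨s, hsF, fun π hπ => ?_⟩
    obtain ⟨hπG, hx⟩ := (hs.2 π).1 hπ
    exact (act_eq_iff (h.isPermGroup.perm π hπG)).2 hx
  · rintro ⟨K, hK, hx⟩
    have hs := small_sep G (fun π => act A π x = x)
    refine ⟨ofSmall hs, ⟨isSet_ofSmall hs, fun π => (mem_ofSmall hs).trans (and_congr_right fun hπ =>
      act_eq_iff (h.isPermGroup.perm π hπ))⟩, h.isNormalFilter.supergroup K _ hK ?_ ?_ ?_⟩
    · exact isPermGroup_stabilizer h.isUrSet h.isPermGroup (isSet_ofSmall hs) fun π => mem_ofSmall hs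
    · exact fun π hπ => ((mem_ofSmall hs).1 hπ).1
    · exact fun π hπ => (mem_ofSmall hs).2 ⟨h.mem_of_mem hπ hK, hx π hπ⟩

/-- If `K` supports `x`, then `π K π⁻¹` supports `π x`; this is where closure under conjugation
enters. -/
theorem isSymmetric_act {x π : M} (hx : IsSymmetric A G F x) (hπ : Mem π G) :
    IsSymmetric A G F (act A π x) := by
  rw [h.isSymmetric_iff] at hx ⊢
  obtain ⟨K, hK, hx⟩ := hx
  obtain ⟨L, hL, hLm⟩ := h.isNormalFilter.conj π K hπ hK
  refine ⟨L, hL, fun σ hσ => ?_⟩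
  obtain ⟨hσG, ρ, hρ, hc⟩ := (hLm σ).1 hσ
  have hρG := h.mem_of_mem hρ hK
  -- The identity `σ π = π ρ` holds on urelements by the choice of `ρ`, hence everywhere.
  have key : act A σ (act A π x) = act A π (act A ρ x) := by
    refine ((h.isHom hσG).comp (h.isHom hπ)).ext ((h.isHom hπ).comp (h.isHom hρG))
      (fun b hb => ?_) x
    have hA := h.isUrSet
    have hG := h.isPermGroup
    by_cases hbA : Mem b A
    · have h₁ := app_act (hG.perm ρ hρG) hb hbA
      have h₂ := (hG.perm ρ hρG).2.1 _ _ h₁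
      exact act_eq_of_app hA hG hσG ((hc _ _).2 ⟨b, _, app_act (hG.perm π hπ) hb hbA, h₁,
        app_act (hG.perm π hπ) (hA.2 _ h₂) h₂⟩)
    · rw [act_of_not_mem (hG.perm π hπ) hb hbA, act_of_not_mem (hG.perm ρ hρG) hb hbA,
        act_of_not_mem (hG.perm σ hσG) hb hbA, act_of_not_mem (hG.perm π hπ) hb hbA]
  rw [key, hx ρ hρ]

theorem mem_permModel_of_ur {a : M} (ha : Ur a) : a ∈ permModel A G F :=
  mem_permModel_iff.2 ⟨h.isNormalFilter.sym_ur a ha, fun _ hy => (hy.isSet ha).elim⟩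

theorem act_mem_permModel {x π : M} (hx : x ∈ permModel A G F) (hπ : Mem π G) :
    act A π x ∈ permModel A G F := by
  revert hx
  refine mem_induction (P := fun x => x ∈ permModel A G F → act A π x ∈ permModel A G F)
    (fun x ih hx => ?_) x
  refine mem_permModel_iff.2 ⟨h.isSymmetric_act hx.1 hπ, fun y hy => ?_⟩
  by_cases hxs : IsSet x
  · obtain ⟨v, hv, rfl⟩ := ((h.isHom hπ).mem x hxs y).1 hy
    exact ih v hv (mem_permModel_of_mem hx hv)
  · exact (hy.isSet ((h.isHom hπ).ur x (not_not.1 hxs))).elim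

/-- A subset of the permutation model that is mapped into itself by all elements of a group in the
filter belongs to the model. -/
theorem mem_permModel_of_forall {x K : M} (hx : IsSet x) (hK : Mem K F)
    (hxW : ∀ y, Mem y x → y ∈ permModel A G F)
    (hKx : ∀ π, Mem π K → ∀ y, Mem y x → Mem (act A π y) x) : x ∈ permModel A G F :=
  mem_permModel_iff.2 ⟨h.isSymmetric_iff.2 ⟨K, hK, fun _ hπ => act_eq_self_of_forall_mem
    h.isUrSet (h.isNormalFilter.subgroup K hK).1 hx hKx hπ⟩, hxW⟩

/-- Finitely many elements of the permutation model have a common support. -/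
theorem exists_support {n : ℕ} (p : Fin n → M) (hp : ∀ i, p i ∈ permModel A G F) :
    ∃ K, Mem K F ∧ ∀ π, Mem π K → ∀ i, act A π (p i) = p i := by
  induction n with
  | zero =>
    obtain ⟨K, hK⟩ := h.isNormalFilter.nonempty
    exact ⟨K, hK, fun _ _ i => i.elim0⟩
  | succ n ih =>
    obtain ⟨K, hK, hKp⟩ := ih (fun i => p i.succ) fun i => hp _
    obtain ⟨L, hL, hLp⟩ := h.isSymmetric_iff.1 (hp 0).1
    obtain ⟨N, hN, hNm⟩ := h.isNormalFilter.inter K L hK hL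
    refine ⟨N, hN, fun π hπ i => ?_⟩
    obtain ⟨hπK, hπL⟩ := (hNm π).1 hπ
    exact Fin.cases (hLp π hπL) (hKp π hπK) i

end NormalSystem

end Action

/-! ### Relativization of formulas to definable classes -/

section Relativization

variable {M : Type*} [lang.Structure M] {α γ : Type}

theorem relMap_mem {v : Fin 2 → M} :
    Language.Structure.RelMap (L := lang) RelSym.mem v ↔ Mem (v 0) (v 1) := by
  unfold Mem
  refine iff_of_eq (congrArg _ (funext fun i => ?_))
  fin_cases i <;> rfl

theorem relMap_ur {v : Fin 1 → M} :
    Language.Structure.RelMap (L := lang) RelSym.ur v ↔ Ur (v 0) := by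
  unfold Ur
  refine iff_of_eq (congrArg _ (funext fun i => ?_))
  fin_cases i; rfl

@[simp]
theorem mem_coe {C : Set M} {x y : C} : Mem (x : M) (y : M) ↔ Mem x y :=
  (relMap_mem (v := fun i => ((![x, y] i : C) : M))).symm

@[simp]
theorem ur_coe {C : Set M} {x : C} : Ur (x : M) ↔ Ur x :=
  (relMap_ur (v := fun i => ((![x] i : C) : M))).symm

@[simp]
theorem isSet_coe {C : Set M} {x : C} : IsSet (x : M) ↔ IsSet x := not_congr ur_coe

/-- The inclusion of a class. -/
def inclusion (C : Set M) : C ↪[lang] M where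
  toFun := Subtype.val
  inj' := Subtype.val_injective
  map_fun' f := Empty.elim f
  map_rel' _ _ := Iff.rfl

/-- The relativization of a formula to the class defined by `χ`. -/
def relativize (χ : lang.Formula (γ ⊕ Unit)) :
    ∀ {n : ℕ}, lang.BoundedFormula α n → lang.BoundedFormula (γ ⊕ α) n
  | _, .falsum => .falsum
  | _, .equal t s => .equal (t.relabel (Sum.map Sum.inr id)) (s.relabel (Sum.map Sum.inr id))
  | _, .rel R ts => .rel R fun i => (ts i).relabel (Sum.map Sum.inr id)
  | _, .imp φ ψ => .imp (relativize χ φ) (relativize χ ψ)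
  | n, .all φ => .all (.imp (BoundedFormula.relabel (n := n + 1)
      (Sum.elim (fun i => Sum.inl (Sum.inl i)) fun _ => Sum.inr (Fin.last n)) χ) (relativize χ φ))

theorem realize_term_embedding {N D : Type*} [lang.Structure N] [lang.Structure D]
    (j : D ↪[lang] N) {n : ℕ} (t : lang.Term (α ⊕ Fin n)) (p : γ → N) (v : α → D)
    (xs : Fin n → D) :
    (t.relabel (Sum.map Sum.inr id)).realize
      (Sum.elim (Sum.elim p (fun i => j (v i))) (fun i => j (xs i))) =
    j (t.realize (Sum.elim v xs)) := by
  cases t with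
  | var i => rcases i with i | i <;> rfl
  | func f _ => exact Empty.elim f

/-- Stated for an embedding `j` whose range `χ` defines, since it is needed both for `W` inside the
universe and for `T ∩ W` inside a reflecting set `T`. -/
theorem realize_relativize {N D : Type*} [lang.Structure N] [lang.Structure D]
    (j : D ↪[lang] N) (χ : lang.Formula (γ ⊕ Unit)) (p : γ → N)
    (hχ : ∀ y, χ.Realize (Sum.elim p (fun _ => y)) ↔ ∃ d, j d = y) {n : ℕ}
    (φ : lang.BoundedFormula α n) (v : α → D) (xs : Fin n → D) :
    (relativize χ φ).Realize (Sum.elim p (fun i => j (v i))) (fun i => j (xs i)) ↔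
      φ.Realize v xs := by
  induction φ with
  | falsum => exact Iff.rfl
  | equal t s =>
    simp only [relativize, BoundedFormula.Realize, realize_term_embedding, j.injective.eq_iff]
  | rel R ts =>
    simp only [relativize, BoundedFormula.Realize, realize_term_embedding]
    exact j.map_rel R _
  | imp φ ψ ih₁ ih₂ => exact imp_congr (ih₁ xs) (ih₂ xs)
  | @all n φ ih =>
    -- The guard of the relativized quantifier is `χ` evaluated at the newly bound, last variable.
    have key : ∀ y, (BoundedFormula.relabel (n := n + 1)
        (Sum.elim (fun i => Sum.inl (Sum.inl i)) fun _ => Sum.inr (Fin.last n) :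
          γ ⊕ Unit → (γ ⊕ α) ⊕ Fin (n + 1)) χ).Realize (Sum.elim p (fun i => j (v i)))
        (Fin.snoc (fun i => j (xs i)) y : Fin (n + 1) → N) ↔ ∃ d, j d = y := by
      intro y
      rw [← hχ, BoundedFormula.realize_relabel (n := 0) (m := n + 1), Formula.Realize]
      refine iff_of_eq (congrArg₂ _ (funext fun i => ?_) (Subsingleton.elim _ _))
      rcases i with i | i
      · rfl
      · simp only [Function.comp_apply, Sum.elim_inr]
        exact Fin.snoc_last (α := fun _ => N) y (fun i => j (xs i))
    have hsnoc : ∀ d, (Fin.snoc (fun i => j (xs i)) (j d) : Fin (n + 1) → N) =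
        fun i => j ((Fin.snoc xs d : Fin (n + 1) → D) i) := fun d =>
      (Fin.comp_snoc (g := j) xs d).symm
    constructor
    · intro h d
      have := h (j d) ((key _).2 ⟨d, rfl⟩)
      rw [hsnoc] at this
      exact (ih _).1 this
    · intro h y hy
      obtain ⟨d, rfl⟩ := (key y).1 hy
      rw [hsnoc]
      exact (ih _).2 (h d)

theorem realize_formula_relativize {N D : Type*} [lang.Structure N] [lang.Structure D]
    (j : D ↪[lang] N) (χ : lang.Formula (γ ⊕ Unit)) (p : γ → N)
    (hχ : ∀ y, χ.Realize (Sum.elim p (fun _ => y)) ↔ ∃ d, j d = y)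
    (φ : lang.Formula α) (v : α → D) :
    Formula.Realize (relativize χ φ) (Sum.elim p (fun i => j (v i))) ↔ φ.Realize v := by
  rw [Formula.Realize, Formula.Realize, ← realize_relativize j χ p hχ φ v default]
  exact iff_of_eq (congrArg _ (Subsingleton.elim _ _))

/-- The formula `φ` holds in the class `C` at `v`, whose values belong to `C`. -/
def RealizeIn (C : Set M) (φ : lang.Formula α) (v : α → M) : Prop :=
  ∃ w : α → C, (∀ i, (w i : M) = v i) ∧ φ.Realize w

theorem realizeIn_coe {C : Set M} {φ : lang.Formula α} {w : α → C} :
    RealizeIn C φ (fun i => (w i : M)) ↔ φ.Realize w := by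
  refine ⟨fun ⟨w', hw', h⟩ => ?_, fun h => ⟨w, fun _ => rfl, h⟩⟩
  obtain rfl : w' = w := funext fun i => Subtype.ext (hw' i)
  exact h

/-- `RealizeIn` fails when an argument lies outside `C`, so witnesses found in the universe land in
the class automatically. -/
theorem RealizeIn.mem {C : Set M} {φ : lang.Formula α} {v : α → M} (h : RealizeIn C φ v)
    (i : α) : v i ∈ C := by
  obtain ⟨w, hw, -⟩ := h
  exact hw i ▸ (w i).2

/-- This is what lets the schemas of the universe be applied to statements about truth in `C`. -/
theorem DefPred.realizeIn (C : Set M) [hC : DefPred (fun v : Unit → M => v () ∈ C)]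
    [Finite α] (φ : lang.Formula α) : DefPred (fun v : α → M => RealizeIn C φ v) := by
  have hC' : ∀ i : α, DefPred (fun v : α → M => v i ∈ C) := fun i =>
    DefPred.subst₁ (R := fun x => x ∈ C) hC (a := fun v => v i)
  obtain ⟨ι, hι, p, χ, hχ⟩ := hC
  have h₁ : DefPred (fun v : α → M => (relativize χ φ).Realize (Sum.elim p v) default) :=
    ⟨ι, hι, p, relativize χ φ, fun _ => Iff.rfl⟩
  have h₂ : DefPred (fun v : α → M => ∀ i, v i ∈ C) := DefPred.forallFinite hC'
  refine (DefPred.and (hP := h₂) (hQ := h₁)).congr fun v => ?_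
  have key : ∀ w : α → C, Formula.Realize (relativize χ φ) (Sum.elim p fun i => (w i : M)) ↔
      φ.Realize w := realize_formula_relativize (inclusion C) χ p (fun y => (hχ _).trans
      ⟨fun h => ⟨⟨y, h⟩, rfl⟩, fun ⟨d, h⟩ => h ▸ d.2⟩) φ
  constructor
  · rintro ⟨hv, h⟩
    exact ⟨fun i => ⟨v i, hv i⟩, fun i => rfl, (key fun i => ⟨v i, hv i⟩).1 h⟩
  · rintro ⟨w, hw, h⟩
    obtain rfl : (fun i => (w i : M)) = v := funext hw
    exact ⟨fun i => (w i).2, (key w).2 h⟩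

end Relativization

/-! ### Invariance of truth in the permutation model -/

section Equivariance

variable {M : Type*} [lang.Structure M] [hM : Fact (ZFUR M)] {A G F : M}

namespace NormalSystem

variable (h : NormalSystem A G F)

include h

theorem mem_act_iff {π x y : M} (hπ : Mem π G) :
    Mem (act A π x) (act A π y) ↔ Mem x y := by
  obtain ⟨ρ, hρ, -, hinv, -⟩ := exists_act_inv h.isUrSet h.isPermGroup hπ
  refine ⟨fun hm => ?_, (h.isHom hπ).mem_of_mem⟩
  simpa only [hinv] using (h.isHom hρ).mem_of_mem hm

theorem ur_act_iff {π x : M} (hπ : Mem π G) : Ur (act A π x) ↔ Ur x :=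
  ⟨not_imp_not.1 ((h.isHom hπ).isSet x), (h.isHom hπ).ur x⟩

/-- Truth in the permutation model is invariant under the group. -/
theorem realize_act {α : Type} (φ : lang.Formula α) {π : M} (hπ : Mem π G)
    (w : α → permModel A G F) :
    φ.Realize (fun i => (⟨act A π (w i), h.act_mem_permModel (w i).2 hπ⟩ : permModel A G F)) ↔
      φ.Realize w := by
  obtain ⟨ρ, hρ, -, hinv, hinv'⟩ := exists_act_inv h.isUrSet h.isPermGroup hπ
  -- The restriction of `π` is an automorphism of the model, and automorphisms preserve all
  -- formulas.
  let e : permModel A G F ≃[lang] permModel A G F :=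
    { toFun := fun x => ⟨act A π x, h.act_mem_permModel x.2 hπ⟩
      invFun := fun x => ⟨act A ρ x, h.act_mem_permModel x.2 hρ⟩
      left_inv := fun x => Subtype.ext (hinv x)
      right_inv := fun x => Subtype.ext (hinv' x)
      map_fun' := fun f => Empty.elim f
      map_rel' := fun R v => by
        cases R with
        | mem => exact relMap_mem.trans (mem_coe.symm.trans
            ((h.mem_act_iff hπ).trans (mem_coe.trans relMap_mem.symm)))
        | ur => exact relMap_ur.trans (ur_coe.symm.trans
            ((h.ur_act_iff hπ).trans (ur_coe.trans relMap_ur.symm))) }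
  exact StrongHomClass.realize_formula e φ (v := w)

theorem realizeIn_act {α : Type} {φ : lang.Formula α} {π : M} (hπ : Mem π G) {v : α → M}
    (hv : RealizeIn (permModel A G F) φ v) :
    RealizeIn (permModel A G F) φ (fun i => act A π (v i)) := by
  obtain ⟨w, hw, hφ⟩ := hv
  exact ⟨_, fun i => congrArg (act A π) (hw i), (h.realize_act φ hπ w).2 hφ⟩

end NormalSystem

end Equivariance

section VecCons

variable {M : Type*}

theorem coe_vecCons {C : Set M} {n : ℕ} (x : C) (p : Fin n → C) :
    (fun i => ((Matrix.vecCons x p : Fin (n + 1) → C) i : M)) =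
      Matrix.vecCons (x : M) (fun i => (p i : M)) :=
  funext fun i => Fin.cases rfl (fun _ => rfl) i

theorem comp_vecCons {n : ℕ} (f : M → M) (x : M) (p : Fin n → M) :
    (fun i => f ((Matrix.vecCons x p : Fin (n + 1) → M) i)) =
      Matrix.vecCons (f x) (fun i => f (p i)) :=
  funext fun i => Fin.cases rfl (fun _ => rfl) i

end VecCons

/-! ### ZFU_R and Collection in the permutation model -/

section PermutationModel

variable {M : Type*} [lang.Structure M]

theorem realizeIn_vecCons {C : Set M} {n : ℕ} {φ : lang.Formula (Fin (n + 1))} {x : C}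
    {p : Fin n → C} : RealizeIn C φ (Matrix.vecCons (x : M) (fun i => (p i : M))) ↔
      φ.Realize (Matrix.vecCons x p) := by
  rw [← coe_vecCons, realizeIn_coe]

theorem realizeIn_vecCons₂ {C : Set M} {n : ℕ} {φ : lang.Formula (Fin (n + 2))} {x y : C}
    {p : Fin n → C} :
    RealizeIn C φ (Matrix.vecCons (x : M) (Matrix.vecCons (y : M) (fun i => (p i : M)))) ↔
      φ.Realize (Matrix.vecCons x (Matrix.vecCons y p)) := by
  rw [← coe_vecCons, realizeIn_vecCons]

theorem IsPure.of_mem {x y : M} (hx : IsPure x) (hy : Mem y x) : IsPure y :=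
  ⟨hx.2 y (InTC.of_mem hy), fun _ hz => hx.2 _ (hz.of_mem_of_inTC hy)⟩

variable [hM : Fact (ZFUR M)] {A G F : M}

theorem sub_coe {x y : permModel A G F} : Sub (x : M) (y : M) ↔ Sub x y := by
  constructor
  · intro h z hz
    exact mem_coe.1 (h z (mem_coe.2 hz))
  · intro h z hz
    exact mem_coe.2 (h ⟨z, mem_permModel_of_mem x.2 hz⟩ (mem_coe.1 hz))

theorem IsPure.of_forall_mem {x : M} (hx : IsSet x) (h : ∀ y, Mem y x → IsPure y) : IsPure x := by
  refine ⟨hx, fun z hz => ?_⟩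
  rcases inTC_iff.1 hz with hz | ⟨y, hy, hz⟩
  · exact (h z hz).1
  · exact (h y hy).2 z hz

theorem isPure_of_mem_omega {n : M} (hn : Mem n (omega M)) : IsPure n := by
  refine omega_induction (P := IsPure) ?_ (fun n _ hn => ?_) hn
  · exact IsPure.of_forall_mem isSet_empty fun y hy => (not_mem_empty y hy).elim
  · refine IsPure.of_forall_mem (isSet_insert n n) fun y hy => ?_
    rcases mem_insert.1 hy with rfl | hy
    · exact hn
    · exact hn.of_mem hy

namespace NormalSystem

variable (h : NormalSystem A G F)

include h

theorem act_eq_self_of_isPure {x π : M} (hx : IsPure x) (hπ : Mem π G) : act A π x = x := by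
  refine mem_induction (P := fun x => IsPure x → act A π x = x) (fun x ih hx => ?_) x hx
  refine UrSet.ext ((h.isHom hπ).isSet x hx.1) hx.1 fun u => ?_
  rw [(h.isHom hπ).mem x hx.1]
  constructor
  · rintro ⟨v, hv, rfl⟩
    rwa [ih v hv (hx.of_mem hv)]
  · intro hu
    exact ⟨u, hu, (ih u hu (hx.of_mem hu)).symm⟩

/-- Hereditarily fixed sets belong to the permutation model. -/
theorem mem_permModel_of_forall_act_eq {x : M} (hx : IsSet x)
    (hxW : ∀ y, Mem y x → y ∈ permModel A G F)
    (hG : ∀ y, Mem y x → ∀ π, Mem π G → act A π y = y) : x ∈ permModel A G F := by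
  obtain ⟨K, hK⟩ := h.isNormalFilter.nonempty
  exact h.mem_permModel_of_forall hx hK hxW fun π hπ y hy =>
    (hG y hy π (h.mem_of_mem hπ hK)).symm ▸ hy

theorem mem_permModel_of_isPure {x : M} (hx : IsPure x) : x ∈ permModel A G F :=
  mem_induction (P := fun x => IsPure x → x ∈ permModel A G F) (fun _ ih hx =>
    h.mem_permModel_of_forall_act_eq hx.1 (fun y hy => ih y hy (hx.of_mem hy))
      fun _ hy _ hπ => h.act_eq_self_of_isPure (hx.of_mem hy) hπ) x hx

/-- Small subclasses of the permutation model with a support belong to it. -/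
theorem exists_of_small {P : M → Prop} (hP : Small P) (hPW : ∀ y, P y → y ∈ permModel A G F)
    {K : M} (hK : Mem K F) (hKP : ∀ π, Mem π K → ∀ y, P y → P (act A π y)) :
    ∃ v : permModel A G F, IsSet v ∧ ∀ y : M, Mem y v ↔ P y := by
  refine ⟨⟨ofSmall hP, h.mem_permModel_of_forall (isSet_ofSmall hP) hK ?_ ?_⟩,
    isSet_coe.1 (isSet_ofSmall hP), fun y => mem_ofSmall hP⟩
  · exact fun y hy => hPW y ((mem_ofSmall hP).1 hy)
  · exact fun π hπ y hy => (mem_ofSmall hP).2 (hKP π hπ y ((mem_ofSmall hP).1 hy))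

theorem exists_support_cons {n : ℕ} (x : permModel A G F) (p : Fin n → permModel A G F) :
    ∃ K, Mem K F ∧ ∀ π, Mem π K → act A π x = x ∧ ∀ i, act A π (p i) = p i := by
  obtain ⟨K, hK, hKp⟩ := h.exists_support
    (fun i => ((Matrix.vecCons x p : Fin (n + 1) → permModel A G F) i : M)) fun i => Subtype.property _
  exact ⟨K, hK, fun π hπ => ⟨hKp π hπ 0, fun i => hKp π hπ i.succ⟩⟩

theorem act_mem_of_mem {π x y : M} (hπ : Mem π G) (hx : act A π x = x) (hy : Mem y x) :
    Mem (act A π y) x :=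
  hx ▸ (h.mem_act_iff hπ).2 hy

end NormalSystem

section

variable {α : Type}

instance {n : ℕ} {φ : lang.Formula (Fin (n + 1))} {a : (α → M) → M} [ha : DefFun a]
    {p : Fin n → M} :
    DefPred (fun v => RealizeIn (permModel A G F) φ (Matrix.vecCons (a v) p)) :=
  (DefPred.realizeIn (permModel A G F) φ).subst (t := fun i v => (Matrix.vecCons (a v) p) i)
    fun i => Fin.cases ha (fun i => DefFun.const (p i)) i

instance {n : ℕ} {φ : lang.Formula (Fin (n + 2))} {a b : (α → M) → M} [ha : DefFun a]
    [hb : DefFun b] {p : Fin n → M} : DefPred (fun v =>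
      RealizeIn (permModel A G F) φ (Matrix.vecCons (a v) (Matrix.vecCons (b v) p))) :=
  (DefPred.realizeIn (permModel A G F) φ).subst
    (t := fun i v => (Matrix.vecCons (a v) (Matrix.vecCons (b v) p)) i)
    fun i => Fin.cases ha (fun i => Fin.cases hb (fun i => DefFun.const (p i)) i) i

end

namespace NormalSystem

variable (h : NormalSystem A G F)

include h

theorem realizeIn_act_cons {n : ℕ} {φ : lang.Formula (Fin (n + 1))} {x π : M}
    {p : Fin n → M} (hπ : Mem π G) (hp : ∀ i, act A π (p i) = p i)
    (hx : RealizeIn (permModel A G F) φ (Matrix.vecCons x p)) :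
    RealizeIn (permModel A G F) φ (Matrix.vecCons (act A π x) p) := by
  have := h.realizeIn_act hπ hx
  simpa only [comp_vecCons, hp] using this

theorem realizeIn_act_cons₂ {n : ℕ} {φ : lang.Formula (Fin (n + 2))} {x y π : M}
    {p : Fin n → M} (hπ : Mem π G) (hp : ∀ i, act A π (p i) = p i)
    (hx : RealizeIn (permModel A G F) φ (Matrix.vecCons x (Matrix.vecCons y p))) :
    RealizeIn (permModel A G F) φ
      (Matrix.vecCons (act A π x) (Matrix.vecCons (act A π y) p)) := by
  have := h.realizeIn_act hπ hx
  simpa only [comp_vecCons, hp] using this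

/-- Permutation models satisfy ZF with urelements. -/
theorem zfur : ZFUR (permModel A G F) where
  ur_no_mem a x ha hx := hM.out.ur_no_mem a x (ur_coe.2 ha) (mem_coe.2 hx)
  extensionality x y hx hy hm := by
    refine Subtype.ext (UrSet.ext (isSet_coe.2 hx) (isSet_coe.2 hy) fun z => ?_)
    constructor
    · intro hz
      exact mem_coe.2 ((hm ⟨z, mem_permModel_of_mem x.2 hz⟩).1 (mem_coe.1 hz))
    · intro hz
      exact mem_coe.2 ((hm ⟨z, mem_permModel_of_mem y.2 hz⟩).2 (mem_coe.1 hz))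
  foundation := by
    rintro x ⟨y, hy⟩
    obtain ⟨z, hz, hm⟩ := hM.out.foundation x ⟨y, mem_coe.2 hy⟩
    exact ⟨⟨z, mem_permModel_of_mem x.2 hz⟩, mem_coe.1 hz, fun w hw hwx =>
      hm w (mem_coe.2 hw) (mem_coe.2 hwx)⟩
  pairing x y := by
    obtain ⟨K, hK, hKp⟩ := h.exists_support_cons x ![y]
    obtain ⟨v, hv, hm⟩ := h.exists_of_small (small_upair (x : M) y)
      (by rintro _ (rfl | rfl) <;> exact Subtype.property _) hK (by
        rintro π hπ _ (rfl | rfl)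
        · exact Or.inl (hKp π hπ).1
        · exact Or.inr ((hKp π hπ).2 0))
    exact ⟨v, hv, fun w => by rw [← mem_coe, hm, Subtype.ext_iff, Subtype.ext_iff]⟩
  union x _ := by
    obtain ⟨K, hK, hKp⟩ := h.exists_support_cons x ![]
    obtain ⟨v, hv, hm⟩ := h.exists_of_small (small_sUnion (x : M))
      (fun z ⟨y, hy, hz⟩ => mem_permModel_of_mem (mem_permModel_of_mem x.2 hy) hz) hK (by
        rintro π hπ z ⟨y, hy, hz⟩
        have hπG := h.mem_of_mem hπ hK
        exact ⟨act A π y, h.act_mem_of_mem hπG (hKp π hπ).1 hy, (h.mem_act_iff hπG).2 hz⟩)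
    refine ⟨v, hv, fun w => ?_⟩
    rw [← mem_coe, hm]
    constructor
    · rintro ⟨y, hy, hw⟩
      exact ⟨⟨y, mem_permModel_of_mem x.2 hy⟩, mem_coe.1 hy, mem_coe.1 hw⟩
    · rintro ⟨y, hy, hw⟩
      exact ⟨y, mem_coe.2 hy, mem_coe.2 hw⟩
  powerset x _ := by
    obtain ⟨K, hK, hKp⟩ := h.exists_support_cons x ![]
    have hs : Small (fun y => (IsSet y ∧ Sub y (x : M)) ∧ y ∈ permModel A G F) :=
      (small_powerset (x : M)).of_subset fun y hy => hy.1
    obtain ⟨v, hv, hm⟩ := h.exists_of_small hs (fun y hy => hy.2) hK (by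
      rintro π hπ y ⟨⟨hys, hy⟩, hyW⟩
      have hπG := h.mem_of_mem hπ hK
      refine ⟨⟨(h.isHom hπG).isSet y hys, fun z hz => ?_⟩, h.act_mem_permModel hyW hπG⟩
      obtain ⟨u, hu, rfl⟩ := ((h.isHom hπG).mem y hys z).1 hz
      exact h.act_mem_of_mem hπG (hKp π hπ).1 (hy u hu))
    refine ⟨v, hv, fun w => ?_⟩
    rw [← mem_coe, hm, isSet_coe, sub_coe]
    exact and_iff_left w.2
  infinity := by
    have hn : ∀ n, Mem n (omega M) → n ∈ permModel A G F := fun n hn =>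
      h.mem_permModel_of_isPure (isPure_of_mem_omega hn)
    have he := isInductive_omega (M := M)
    refine ⟨⟨omega M, h.mem_permModel_of_forall_act_eq (isSet_ofSmall _) hn fun n hn π hπ =>
      h.act_eq_self_of_isPure (isPure_of_mem_omega hn) hπ⟩, isSet_coe.1 (isSet_ofSmall _),
      ⟨⟨empty M, hn _ he.1⟩, mem_coe.1 he.1, isSet_coe.1 isSet_empty, fun z hz =>
        not_mem_empty (z : M) (mem_coe.2 hz)⟩, fun x hx => ?_⟩
    have hx' := he.2 x (mem_coe.2 hx)
    refine ⟨⟨insert x x, hn _ hx'⟩, mem_coe.1 hx', fun z => ?_⟩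
    rw [← mem_coe, ← mem_coe, Subtype.ext_iff, or_comm]
    exact mem_insert
  separation n φ p x _ := by
    obtain ⟨K, hK, hKp⟩ := h.exists_support_cons x p
    obtain ⟨v, hv, hm⟩ := h.exists_of_small (small_sep (x : M) fun y =>
      RealizeIn (permModel A G F) φ (Matrix.vecCons y (fun i => (p i : M))))
      (fun y hy => mem_permModel_of_mem x.2 hy.1) hK (by
        rintro π hπ y ⟨hy, hφ⟩
        have hπG := h.mem_of_mem hπ hK
        exact ⟨h.act_mem_of_mem hπG (hKp π hπ).1 hy,
          h.realizeIn_act_cons hπG (hKp π hπ).2 hφ⟩)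
    exact ⟨v, hv, fun y => by rw [← mem_coe, hm, mem_coe, realizeIn_vecCons]⟩
  replacement n φ p w _ hφ := by
    obtain ⟨K, hK, hKp⟩ := h.exists_support_cons w p
    -- Functionality is known only for arguments and values in the model: the arguments are members
    -- of `w`, and `RealizeIn` forces the values into it.
    have hs := small_partial_image (w : M) (fun x y => RealizeIn (permModel A G F) φ
      (Matrix.vecCons x (Matrix.vecCons y (fun i => (p i : M))))) fun x y z hx hy hz => by
        have hxW := mem_permModel_of_mem w.2 hx
        have hyW := hy.mem 1
        have hzW := hz.mem 1
        lift x to permModel A G F using hxW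
        lift y to permModel A G F using hyW
        lift z to permModel A G F using hzW
        rw [realizeIn_vecCons₂] at hy hz
        rw [(hφ x (mem_coe.1 hx)).unique hy hz]
    obtain ⟨v, hv, hm⟩ := h.exists_of_small hs (fun y ⟨x, _, hxy⟩ => hxy.mem 1) hK (by
      rintro π hπ y ⟨x, hx, hxy⟩
      have hπG := h.mem_of_mem hπ hK
      exact ⟨act A π x, h.act_mem_of_mem hπG (hKp π hπ).1 hx,
        h.realizeIn_act_cons₂ hπG (hKp π hπ).2 hxy⟩)
    refine ⟨v, hv, fun y => ?_⟩
    rw [← mem_coe, hm]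
    constructor
    · rintro ⟨x, hx, hxy⟩
      exact ⟨⟨x, mem_permModel_of_mem w.2 hx⟩, mem_coe.1 hx,
        realizeIn_vecCons₂ (x := ⟨x, mem_permModel_of_mem w.2 hx⟩) |>.1 hxy⟩
    · rintro ⟨x, hx, hxy⟩
      exact ⟨x, mem_coe.2 hx, realizeIn_vecCons₂.2 hxy⟩

-- The orbit of `v` is a set that includes `v` (`mem_orbit`) and is closed under the group
-- (`orbit_act`); it is the means of making sets symmetric.
omit h in
theorem small_orbit (A G v : M) :
    Small (fun z => ∃ y, Mem y v ∧ ∃ π, Mem π G ∧ z = act A π y) := by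
  have hF : DefFun (fun u : Unit → M => ofSmall (small_image G fun π => act A π (u ()))) :=
    DefFun.of_mem (fun _ => isSet_ofSmall _) fun _ _ => mem_ofSmall _
  exact (small_biUnion v fun y => ofSmall (small_image G fun π => act A π y)).congr
    fun z => by simp only [mem_ofSmall]

theorem orbit_act {v z σ : M} (hσ : Mem σ G)
    (hz : ∃ y, Mem y v ∧ ∃ π, Mem π G ∧ z = act A π y) :
    ∃ y, Mem y v ∧ ∃ π, Mem π G ∧ act A σ z = act A π y := by
  obtain ⟨y, hy, π, hπ, rfl⟩ := hz
  obtain ⟨ρ, hρ, hm⟩ := h.isPermGroup.mul σ π hσ hπ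
  exact ⟨y, hy, ρ, hρ, (act_eq_act_act h.isUrSet h.isPermGroup hσ hπ hρ hm y).symm⟩

theorem mem_orbit {v y : M} (hy : Mem y v) :
    ∃ x, Mem x v ∧ ∃ π, Mem π G ∧ y = act A π x := by
  obtain ⟨ι, hι, hm⟩ := h.isPermGroup.one
  exact ⟨y, hy, ι, hι, (act_eq_self_of_app h.isUrSet h.isPermGroup hι hm y).symm⟩

/-- Permutation models inherit Collection. -/
theorem collection (hc : Collection M) : Collection (permModel A G F) := by
  intro n φ p w _ hφ
  obtain ⟨v, hv⟩ := hc.exists (w : M) (fun x y => RealizeIn (permModel A G F) φ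
      (Matrix.vecCons x (Matrix.vecCons y (fun i => (p i : M))))) fun x hx => by
    obtain ⟨y, hy⟩ := hφ ⟨x, mem_permModel_of_mem w.2 hx⟩ (mem_coe.1 hx)
    exact ⟨y, realizeIn_vecCons₂ (x := ⟨x, mem_permModel_of_mem w.2 hx⟩) |>.2 hy⟩
  -- A collecting set may contain superfluous elements, so closing under the whole group is harmless
  -- and any member of the filter is a support.
  have hs := small_orbit A G (ofSmall (small_sep v fun y => y ∈ permModel A G F))
  obtain ⟨K, hK⟩ := h.isNormalFilter.nonempty
  obtain ⟨u, hu, hm⟩ := h.exists_of_small hs (by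
    rintro z ⟨y, hy, π, hπ, rfl⟩
    exact h.act_mem_permModel ((mem_ofSmall _).1 hy).2 hπ) hK
    fun π hπ y hy => h.orbit_act (h.mem_of_mem hπ hK) hy
  refine ⟨u, hu, fun x hx => ?_⟩
  obtain ⟨y, hy, hxy⟩ := hv x (mem_coe.2 hx)
  have hyW : y ∈ permModel A G F := hxy.mem 1
  lift y to permModel A G F using hyW
  exact ⟨y, mem_coe.1 ((hm y).2 (h.mem_orbit ((mem_ofSmall _).2 ⟨hy, y.2⟩))),
    realizeIn_vecCons₂.1 hxy⟩

end NormalSystem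

end PermutationModel

/-! ### Reflection in the permutation model -/

section Reflection

variable {M : Type*} [lang.Structure M] {α β : Type}

/-- The formula `φ` is absolute between the universe and the elements of `T`. -/
def Reflects (T : M) (φ : lang.Formula α) : Prop :=
  ∀ a : α → {y : M | Mem y T}, φ.Realize (fun i => (a i : M)) ↔ φ.Realize a

/-- A formula that codes both `φ` and `ψ`, depending on the equality of two variables. -/
def switch (φ : lang.Formula α) (ψ : lang.Formula β) : lang.Formula ((α ⊕ β) ⊕ Fin 2) :=
  let e : lang.Formula ((α ⊕ β) ⊕ Fin 2) :=
    Term.equal (Term.var (Sum.inr 0)) (Term.var (Sum.inr 1))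
  (e.imp (φ.relabel fun i => Sum.inl (Sum.inl i))) ⊓
    (e.not.imp (ψ.relabel fun i => Sum.inl (Sum.inr i)))

theorem realize_switch {N : Type*} [lang.Structure N] {φ : lang.Formula α} {ψ : lang.Formula β}
    {v : (α ⊕ β) ⊕ Fin 2 → N} : (switch φ ψ).Realize v ↔
      (v (Sum.inr 0) = v (Sum.inr 1) → φ.Realize fun i => v (Sum.inl (Sum.inl i))) ∧
      (v (Sum.inr 0) ≠ v (Sum.inr 1) → ψ.Realize fun i => v (Sum.inl (Sum.inr i))) := by
  simp only [switch, Formula.realize_inf, Formula.realize_imp, Formula.realize_not,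
    Formula.realize_equal, Formula.realize_relabel, Term.realize_var]
  rfl

/-- Both branches can be selected by parameters from `T` because it has two distinct elements; the
variables of the other formula are filled with `c`. Iterating this reflects several formulas at
once. -/
theorem Reflects.of_switch {T c d : M} (hc : Mem c T) (hd : Mem d T) (hcd : c ≠ d)
    {φ : lang.Formula α} {ψ : lang.Formula β} (h : Reflects T (switch φ ψ)) :
    Reflects T φ ∧ Reflects T ψ := by
  constructor
  · intro a
    have := h (Sum.elim (Sum.elim a fun _ => ⟨c, hc⟩) fun _ => ⟨c, hc⟩)
    simpa [realize_switch] using this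
  · intro a
    have := h (Sum.elim (Sum.elim (fun _ => ⟨c, hc⟩) a) ![⟨c, hc⟩, ⟨d, hd⟩])
    simpa [realize_switch, hcd] using this

theorem Reflection.exists_reflects (hr : Reflection M) [Finite α] (φ : lang.Formula α) {x : M}
    (hx : IsSet x) : ∃ T, IsTransSet T ∧ Sub x T ∧ Reflects T φ := by
  obtain ⟨n, ⟨e⟩⟩ := Finite.exists_equiv_fin α
  obtain ⟨T, hT, hxT, h⟩ := hr n (φ.relabel e) x hx
  refine ⟨T, hT, hxT, fun a => ?_⟩
  have := h (fun i => a (e.symm i))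
  simpa [Formula.realize_relabel, Function.comp_def] using this

/-- The formula `∃ s, θ(y, s)`. -/
noncomputable def exSnd (θ : lang.Formula (α ⊕ Fin 2)) : lang.Formula (α ⊕ Unit) :=
  Formula.iExs Unit (θ.relabel (Sum.elim (fun i => Sum.inl (Sum.inl i))
    ![Sum.inl (Sum.inr ()), Sum.inr ()]))

theorem realize_exSnd {N : Type*} [lang.Structure N] {θ : lang.Formula (α ⊕ Fin 2)} {p : α → N}
    {y : N} : (exSnd θ).Realize (Sum.elim p fun _ => y) ↔
      ∃ s, θ.Realize (Sum.elim p ![y, s]) := by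
  rw [exSnd, Formula.realize_iExs]
  have key : ∀ w : Unit → N, (Sum.elim (Sum.elim p fun _ : Unit => y) w) ∘
      (Sum.elim (fun i => Sum.inl (Sum.inl i)) ![Sum.inl (Sum.inr ()), Sum.inr ()] :
        α ⊕ Fin 2 → (α ⊕ Unit) ⊕ Unit) = Sum.elim p ![y, w ()] := by
    intro w
    funext i
    rcases i with i | i
    · rfl
    · fin_cases i <;> rfl
  simp only [Formula.realize_relabel, key]
  exact ⟨fun ⟨w, hw⟩ => ⟨w (), hw⟩, fun ⟨s, hs⟩ => ⟨fun _ => s, hs⟩⟩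

variable [hM : Fact (ZFUR M)]

theorem exists_set_finite [Finite α] (p : α → M) (x : M) :
    ∃ y, IsSet y ∧ Sub x y ∧ ∀ i, Mem (p i) y := by
  obtain ⟨n, ⟨e⟩⟩ := Finite.exists_equiv_fin α
  suffices h : ∀ (n : ℕ) (p : Fin n → M), ∃ y, IsSet y ∧ Sub x y ∧ ∀ i, Mem (p i) y by
    obtain ⟨y, hy, hxy, hp⟩ := h n (p ∘ e.symm)
    exact ⟨y, hy, hxy, fun i => by simpa using hp (e i)⟩
  intro n
  induction n with
  | zero =>
    intro p
    exact ⟨_, isSet_ofSmall (small_mem x), fun z hz => (mem_ofSmall _).2 hz, fun i => i.elim0⟩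
  | succ n ih =>
    intro p
    obtain ⟨y, hy, hxy, hp⟩ := ih fun i => p i.succ
    exact ⟨insert (p 0) y, isSet_insert _ _, fun z hz => mem_insert.2 (Or.inr (hxy z hz)),
      fun i => mem_insert.2 (Fin.cases (Or.inl rfl) (fun i => Or.inr (hp i)) i)⟩

namespace NormalSystem

variable {A G F : M} (h : NormalSystem A G F)

include h

/-- Every object belongs to a transitive set that is fixed by the group. -/
theorem exists_invariant_transSet (x : M) :
    ∃ s, Mem x s ∧ IsTransSet s ∧ ∀ π, Mem π G → act A π s = s := by
  obtain ⟨t, ht, hx⟩ := exists_transSet_mem x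
  have hs := small_orbit A G t
  refine ⟨ofSmall hs, (mem_ofSmall hs).2 (h.mem_orbit hx), ⟨isSet_ofSmall hs, fun z hz u hu => ?_⟩,
    fun π hπ => act_eq_self_of_forall_mem h.isUrSet h.isPermGroup (isSet_ofSmall hs)
      (fun π hπ z hz => (mem_ofSmall hs).2 (h.orbit_act hπ ((mem_ofSmall hs).1 hz))) hπ⟩
  obtain ⟨y, hy, π, hπ, rfl⟩ := (mem_ofSmall hs).1 hz
  have hys : IsSet y := fun hy => hu.isSet ((h.isHom hπ).ur y hy)
  obtain ⟨v, hv, rfl⟩ := ((h.isHom hπ).mem y hys u).1 hu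
  exact (mem_ofSmall hs).2 ⟨v, ht.2 y hy v hv, π, hπ, rfl⟩

/-- Permutation models inherit Reflection. -/
theorem reflection (hr : Reflection M) : Reflection (permModel A G F) := by
  intro n φ x hx
  obtain ⟨ι, hι, p, χ, hχ⟩ :=
    (inferInstance : DefPred fun v : Unit → M => v () ∈ permModel A G F)
  -- `θ(y, s)` says that `s` is a transitive set containing `y` and fixed by the group.
  obtain ⟨κ, hκ, q, θ, hθ⟩ := (inferInstance : DefPred fun v : Fin 2 → M =>
    Mem (v 0) (v 1) ∧ IsTransSet (v 1) ∧ ∀ π, Mem π G → act A π (v 1) = v 1)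
  -- All parameters, and `0 ≠ 1` for the switches, must be elements of the reflecting set.
  obtain ⟨x', hx', hxx', hp⟩ := exists_set_finite
    (Sum.elim (Sum.elim p q) ![empty M, insert (empty M) (empty M)]) (x : M)
  obtain ⟨T, hT, hxT, hTr⟩ := hr.exists_reflects
    (switch (switch θ (exSnd θ)) (switch χ (relativize χ φ))) hx'
  have hp' := fun i => hxT _ (hp i)
  have hc : Mem (empty M) T := hp' (Sum.inr 0)
  have hd : Mem (insert (empty M) (empty M)) T := hp' (Sum.inr 1)
  have hcd := (insert_self_ne_empty (empty M)).symm
  obtain ⟨h₁, h₂⟩ := hTr.of_switch hc hd hcd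
  obtain ⟨hTθ, hTe⟩ := h₁.of_switch hc hd hcd
  obtain ⟨hTχ, hTφ⟩ := h₂.of_switch hc hd hcd
  let p' : ι → {y : M | Mem y T} := fun i => ⟨p i, hp' (Sum.inl (Sum.inl i))⟩
  let q' : κ → {y : M | Mem y T} := fun i => ⟨q i, hp' (Sum.inl (Sum.inr i))⟩
  have hcoe : ∀ {γ : Type} (a : γ → {y : M | Mem y T}), (fun i => ((Sum.elim p' a i :
      {y : M | Mem y T}) : M)) = Sum.elim p fun i => (a i : M) := fun a =>
    funext fun i => by cases i <;> rfl
  have hcoe' : ∀ {γ : Type} (a : γ → {y : M | Mem y T}), (fun i => ((Sum.elim q' a i :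
      {y : M | Mem y T}) : M)) = Sum.elim q fun i => (a i : M) := fun a =>
    funext fun i => by cases i <;> rfl
  -- Reflecting `∃ s, θ` finds `s` inside `T`; reflecting `θ` itself shows that this `s` has the
  -- required properties in the universe.
  have hT₁ : ∀ y : {y : M | Mem y T}, ∃ s, Mem s T ∧ Mem (y : M) s ∧ IsTransSet s ∧
      ∀ π, Mem π G → act A π s = s := by
    intro y
    obtain ⟨s, hs⟩ := h.exists_invariant_transSet (y : M)
    have hy := (hTe (Sum.elim q' fun _ => y)).1 (by
      rw [hcoe', realize_exSnd]
      exact ⟨s, (hθ ![y, s]).2 hs⟩)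
    obtain ⟨s', hs'⟩ := realize_exSnd.1 hy
    have hs'' := (hTθ _).2 hs'
    rw [hcoe', hθ] at hs''
    exact ⟨s', s'.2, hs''⟩
  -- `π y ∈ π s = s ⊆ T`.
  have hTG : ∀ π, Mem π G → ∀ y, Mem y T → Mem (act A π y) T := by
    intro π hπ y hy
    obtain ⟨s, hsT, hys, -, hs⟩ := hT₁ ⟨y, hy⟩
    exact hT.2 s hsT _ (h.act_mem_of_mem hπ (hs π hπ) hys)
  obtain ⟨K, hK⟩ := h.isNormalFilter.nonempty
  obtain ⟨t, ht, htm⟩ := h.exists_of_small (small_sep T fun y => y ∈ permModel A G F)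
    (fun y hy => hy.2) hK fun π hπ y hy =>
      have hπG := h.mem_of_mem hπ hK
      ⟨hTG π hπG y hy.1, h.act_mem_permModel hy.2 hπG⟩
  have htm' : ∀ y : permModel A G F, Mem y t ↔ Mem (y : M) T := fun y => by
    rw [← mem_coe, htm]
    exact and_iff_left y.2
  refine ⟨t, ⟨ht, fun y hy z hz => ?_⟩, fun y hy => ?_, fun a => ?_⟩
  · rw [htm'] at hy ⊢
    exact hT.2 _ hy _ (mem_coe.2 hz)
  · exact (htm' y).2 (hxT _ (hxx' _ (mem_coe.2 hy)))
  · let j : {y : permModel A G F | Mem y t} ↪[lang] {y : M | Mem y T} :=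
      { toFun := fun y => ⟨y, (htm' y).1 y.2⟩
        inj' := fun y z hyz => Subtype.ext (Subtype.ext (congrArg (Subtype.val : {y : M | Mem y T} → M) hyz))
        map_fun' := fun f => Empty.elim f
        map_rel' := fun _ _ => Iff.rfl }
    have h₁ := realize_formula_relativize (inclusion (permModel A G F)) χ p (fun y => (hχ _).trans
      ⟨fun h => ⟨⟨y, h⟩, rfl⟩, fun ⟨d, h⟩ => h ▸ d.2⟩) φ (fun i => (a i : permModel A G F))
    -- As `T` reflects `χ`, the formula `χ` evaluated in `T` defines exactly `T ∩ W`. Hence the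
    -- relativization of `φ`, evaluated in `T`, is `φ` evaluated in `t`.
    have h₂ := realize_formula_relativize j χ p' (fun y => by
      rw [← hTχ, hcoe, hχ]
      constructor
      · intro hy
        exact ⟨⟨⟨y, hy⟩, (htm' _).2 y.2⟩, rfl⟩
      · rintro ⟨d, rfl⟩
        exact d.1.2) φ a
    have h₃ := hTφ (Sum.elim p' fun i => j (a i))
    rw [hcoe] at h₃
    exact h₁.symm.trans (h₃.trans h₂)

end NormalSystem

end Reflection

/-! ### Ordinals, Hartogs' theorem and urelements outside a given set -/

section Ordinals

variable {M : Type*} [lang.Structure M]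

theorem IsOrdinal.isTransSet {α : M} (hα : IsOrdinal α) : IsTransSet α := hα.1

theorem IsOrdinal.isPure {α : M} (hα : IsOrdinal α) : IsPure α := hα.2.1

theorem IsOrdinal.trichotomy_mem {α x y : M} (hα : IsOrdinal α) (hx : Mem x α) (hy : Mem y α) :
    Mem x y ∨ x = y ∨ Mem y x := hα.2.2.2.2.1 x y hx hy

theorem isPure_iff_of_isTransSet {t : M} (ht : IsTransSet t) :
    IsPure t ↔ ∀ y, Mem y t → IsSet y := by
  simp only [IsPure, inTC_of_isTransSet ht]
  exact and_iff_right ht.1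

variable [hM : Fact (ZFUR M)]

theorem not_mem_cycle {x y z : M} (hxy : Mem x y) (hyz : Mem y z) : ¬ Mem z x := by
  intro hzx
  obtain ⟨w, hw, hm⟩ := hM.out.foundation (insert x (upair y z)) ⟨x, by simp⟩
  simp only [mem_insert, mem_upair] at hw hm
  rcases hw with rfl | rfl | rfl
  · exact hm _ hzx (by simp)
  · exact hm _ hxy (by simp)
  · exact hm _ hyz (by simp)

/-- Foundation excludes short ∈-cycles, which with trichotomy gives transitivity, and turns
∈-minimal elements into least ones. -/
theorem IsOrdinal.of_trichotomy {α : M} (ht : IsTransSet α) (hp : IsPure α)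
    (h : ∀ x y, Mem x α → Mem y α → Mem x y ∨ x = y ∨ Mem y x) : IsOrdinal α := by
  refine ⟨ht, hp, fun x _ => not_mem_self x, fun x y z hx _ hz hxy hyz => ?_, h,
    fun s hs hne => ?_⟩
  · rcases h x z hx hz with h | rfl | h
    · exact h
    · exact (hxy.asymm hyz).elim
    · exact (not_mem_cycle hxy hyz h).elim
  · obtain ⟨x, hx, hm⟩ := hM.out.foundation s hne
    refine ⟨x, hx, fun y hy => ?_⟩
    rcases h x y (hs x hx) (hs y hy) with h | h | h
    · exact Or.inr h
    · exact Or.inl h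
    · exact (hm y h hy).elim

theorem IsOrdinal.of_mem {α β : M} (hα : IsOrdinal α) (hβ : Mem β α) : IsOrdinal β := by
  have hsub := hα.isTransSet.2 β hβ
  refine IsOrdinal.of_trichotomy ⟨(hα.isPure.of_mem hβ).1, fun y hy z hz => ?_⟩
    (hα.isPure.of_mem hβ) fun x y hx hy => hα.trichotomy_mem (hsub x hx) (hsub y hy)
  exact hα.2.2.2.1 z y β (hα.isTransSet.2 y (hsub y hy) z hz) (hsub y hy) hβ hz hy

/-- If `x ≠ y`, an ∈-minimal element of `y \ x` is equal to `x`. -/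
theorem IsOrdinal.eq_or_mem_of_sub {x y : M} (hx : IsOrdinal x) (hy : IsOrdinal y)
    (h : Sub x y) : x = y ∨ Mem x y := by
  by_cases hyx : Sub y x
  · exact Or.inl (ext hx.isTransSet.1 hy.isTransSet.1 fun z => ⟨h z, hyx z⟩)
  · right
    simp only [Sub, not_forall] at hyx
    obtain ⟨z, hzy, hzx⟩ := hyx
    obtain ⟨z, ⟨hzy, hzx⟩, hm⟩ :=
      exists_minimal (P := fun z => Mem z y ∧ ¬ Mem z x) ⟨hzy, hzx⟩
    have hz := hy.of_mem hzy
    suffices x = z from this ▸ hzy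
    refine ext hx.isTransSet.1 hz.isTransSet.1 fun w => ⟨fun hw => ?_, fun hw => ?_⟩
    · rcases hy.trichotomy_mem (h w hw) hzy with h' | rfl | h'
      · exact h'
      · exact (hzx hw).elim
      · exact (hzx (hx.isTransSet.2 w hw z h')).elim
    · by_contra hwx
      exact hm w hw ⟨hy.isTransSet.2 z hzy w hw, hwx⟩

/-- The intersection is an ordinal. Were it different from both, it would be a member of both and
hence of itself. -/
theorem IsOrdinal.sub_or_sub {x y : M} (hx : IsOrdinal x) (hy : IsOrdinal y) :
    Sub x y ∨ Sub y x := by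
  have hs := small_sep x fun z => Mem z y
  have hd : IsOrdinal (ofSmall hs) := by
    have hdx : Sub (ofSmall hs) x := fun z hz => ((mem_ofSmall hs).1 hz).1
    have ht : IsTransSet (ofSmall hs) := ⟨isSet_ofSmall hs, fun u hu v hv =>
      have hu := (mem_ofSmall hs).1 hu
      (mem_ofSmall hs).2 ⟨hx.isTransSet.2 u hu.1 v hv, hy.isTransSet.2 u hu.2 v hv⟩⟩
    exact IsOrdinal.of_trichotomy ht ((isPure_iff_of_isTransSet ht).2 fun z hz =>
      (hx.of_mem (hdx z hz)).isTransSet.1) fun u v hu hv =>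
        hx.trichotomy_mem (hdx u hu) (hdx v hv)
  rcases hd.eq_or_mem_of_sub hx fun z hz => ((mem_ofSmall hs).1 hz).1 with h₁ | h₁
  · exact Or.inl fun z hz => ((mem_ofSmall hs).1 (by rw [h₁]; exact hz)).2
  · rcases hd.eq_or_mem_of_sub hy fun z hz => ((mem_ofSmall hs).1 hz).2 with h₂ | h₂
    · exact Or.inr fun z hz => ((mem_ofSmall hs).1 (by rw [h₂]; exact hz)).1
    · exact (not_mem_self _ ((mem_ofSmall hs).2 ⟨h₁, h₂⟩)).elim

theorem IsOrdinal.of_forall_mem {γ : M} (ht : IsTransSet γ) (h : ∀ x, Mem x γ → IsOrdinal x) :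
    IsOrdinal γ := by
  refine IsOrdinal.of_trichotomy ht ((isPure_iff_of_isTransSet ht).2 fun x hx =>
    (h x hx).isTransSet.1) fun x y hx hy => ?_
  rcases (h x hx).sub_or_sub (h y hy) with hxy | hxy
  · rcases (h x hx).eq_or_mem_of_sub (h y hy) hxy with h | h
    · exact Or.inr (Or.inl h)
    · exact Or.inl h
  · rcases (h y hy).eq_or_mem_of_sub (h x hx) hxy with h | h
    · exact Or.inr (Or.inl h.symm)
    · exact Or.inr (Or.inr h)

/-- The ordinals do not form a set. -/
theorem not_small_isOrdinal : ¬ Small (fun x : M => IsOrdinal x) := by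
  intro hs
  refine not_mem_self (ofSmall hs) ((mem_ofSmall hs).2 (IsOrdinal.of_forall_mem
    ⟨isSet_ofSmall hs, fun x hx y hy => ?_⟩ fun x hx => (mem_ofSmall hs).1 hx))
  exact (mem_ofSmall hs).2 (((mem_ofSmall hs).1 hx).of_mem hy)

omit hM in
/-- `f` is an injection from `d` into `X`. -/
def IsInj (f d X : M) : Prop :=
  IsFunOn f d ∧ (∀ x y, App f x y → Mem y X) ∧ ∀ x x' y, App f x y → App f x' y → x = x'

/-- The order that the injection `f` transfers from the ordinal `β` to its range is `r`. -/
def IsTransferredOrder (f β r : M) : Prop :=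
  IsSet r ∧ ∀ p, Mem p r ↔ ∃ ζ η x y, (Mem ζ η ∨ ζ = η) ∧ Mem η β ∧ App f ζ x ∧ App f η y ∧
    IsOPair p x y

/-- Induction on `η`: an order isomorphism between ordinals is the identity. The transferred order
is reflexive so that the range of the injection can be recovered from `r`, even for a one-element
ordinal. -/
theorem app_of_isTransferredOrder {X f g β γ r : M} (hβ : IsOrdinal β) (hγ : IsOrdinal γ)
    (hf : IsInj f β X) (hg : IsInj g γ X) (hfr : IsTransferredOrder f β r)
    (hgr : IsTransferredOrder g γ r) {η : M} : ∀ x, App f η x → App g η x := by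
  have key : ∀ {f β}, IsTransferredOrder f β r → ∀ x y, Mem (opair x y) r ↔
      ∃ ζ η, (Mem ζ η ∨ ζ = η) ∧ Mem η β ∧ App f ζ x ∧ App f η y := by
    intro f β h x y
    simp only [h.2, isOPair_iff, opair_inj]
    constructor
    · rintro ⟨ζ, η, x, y, h₁, h₂, h₃, h₄, rfl, rfl⟩
      exact ⟨ζ, η, h₁, h₂, h₃, h₄⟩
    · rintro ⟨ζ, η, h₁, h₂, h₃, h₄⟩
      exact ⟨ζ, η, x, y, h₁, h₂, h₃, h₄, rfl, rfl⟩
  refine mem_induction (P := fun η => ∀ x, App f η x → App g η x) (fun η ih x hx => ?_) η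
  have hηβ := hf.1.mem_dom hx
  obtain ⟨-, θ, -, hθγ, -, hθ⟩ :=
    (key hgr x x).1 ((key hfr x x).2 ⟨η, η, Or.inr rfl, hηβ, hx, hx⟩)
  suffices η = θ from this ▸ hθ
  refine ext (hβ.of_mem hηβ).isTransSet.1 (hγ.of_mem hθγ).isTransSet.1 fun ζ => ?_
  constructor
  · intro hζ
    obtain ⟨y, hy, -⟩ := hf.1.2.2 ζ (hβ.isTransSet.2 η hηβ ζ hζ)
    obtain ⟨ζ', θ', h₁, -, h₃, h₄⟩ :=
      (key hgr y x).1 ((key hfr y x).2 ⟨ζ, η, Or.inl hζ, hηβ, hy, hx⟩)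
    obtain rfl := hg.2.2 _ _ _ h₄ hθ
    obtain rfl := hg.2.2 _ _ _ h₃ (ih ζ hζ y hy)
    rcases h₁ with h₁ | rfl
    · exact h₁
    · obtain rfl := hg.1.unique h₃ h₄
      obtain rfl := hf.2.2 _ _ _ hx hy
      exact (not_mem_self _ hζ).elim
  · intro hζ
    obtain ⟨y, hy, -⟩ := hg.1.2.2 ζ (hγ.isTransSet.2 θ hθγ ζ hζ)
    obtain ⟨ζ', η', h₁, -, h₃, h₄⟩ :=
      (key hfr y x).1 ((key hgr y x).2 ⟨ζ, θ, Or.inl hζ, hθγ, hy, hθ⟩)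
    obtain rfl := hf.2.2 _ _ _ h₄ hx
    rcases h₁ with h₁ | rfl
    · obtain rfl := hg.2.2 _ _ _ hy (ih ζ' h₁ y h₃)
      exact h₁
    · obtain rfl := hf.1.unique h₃ h₄
      obtain rfl := hg.2.2 _ _ _ hy hθ
      exact (not_mem_self _ hζ).elim

theorem eq_of_isTransferredOrder {X f g β γ r : M} (hβ : IsOrdinal β) (hγ : IsOrdinal γ)
    (hf : IsInj f β X) (hg : IsInj g γ X) (hfr : IsTransferredOrder f β r)
    (hgr : IsTransferredOrder g γ r) : β = γ := by
  refine ext hβ.isTransSet.1 hγ.isTransSet.1 fun η => ⟨fun hη => ?_, fun hη => ?_⟩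
  · obtain ⟨x, hx, -⟩ := hf.1.2.2 η hη
    exact hg.1.mem_dom (app_of_isTransferredOrder hβ hγ hf hg hfr hgr x hx)
  · obtain ⟨x, hx, -⟩ := hg.1.2.2 η hη
    exact hf.1.mem_dom (app_of_isTransferredOrder hγ hβ hg hf hgr hfr x hx)

/-- Hartogs' theorem. -/
theorem exists_isOrdinal_not_isInj (X : M) : ∃ β, IsOrdinal β ∧ ∀ f, ¬ IsInj f β X := by
  by_contra! hX
  -- A transferred order is a set of pairs from `X`, hence an element of `P (P (P X))`. It
  -- determines its ordinal, so if every ordinal injected into `X`, Replacement would collect all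
  -- ordinals into a set.
  let P : M → M := fun x => ofSmall (small_powerset x)
  refine not_small_isOrdinal (M := M) ?_
  have hd : DefPred (fun v : Fin 2 → M => IsOrdinal (v 1) ∧ ∃ f, IsInj f (v 1) X ∧
      IsTransferredOrder f (v 1) (v 0)) := by
    unfold IsInj IsTransferredOrder
    infer_instance
  refine (small_partial_image (P (P (P X))) (fun r β => IsOrdinal β ∧ ∃ f, IsInj f β X ∧
    IsTransferredOrder f β r) ?_).congr fun β => ⟨fun ⟨_, _, hβ, _⟩ => hβ, fun hβ => ?_⟩
  · rintro r β γ - ⟨hβ, f, hf, hfr⟩ ⟨hγ, g, hg, hgr⟩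
    exact eq_of_isTransferredOrder hβ hγ hf hg hfr hgr
  · obtain ⟨f, hf⟩ := hX β hβ
    have hsub : ∀ p, (∃ ζ η x y, (Mem ζ η ∨ ζ = η) ∧ Mem η β ∧ App f ζ x ∧ App f η y ∧
        IsOPair p x y) → Mem p (P (P X)) := by
      rintro p ⟨ζ, η, x, y, -, -, hx, hy, hp⟩
      have hx := hf.2.1 _ _ hx
      have hy := hf.2.1 _ _ hy
      obtain rfl := isOPair_iff.1 hp
      refine (mem_ofSmall _).2 ⟨isSet_upair _ _, fun z hz => (mem_ofSmall _).2 ?_⟩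
      rcases mem_upair.1 hz with rfl | rfl <;>
        refine ⟨isSet_upair _ _, fun w hw => ?_⟩ <;>
        rcases mem_upair.1 hw with rfl | rfl <;> assumption
    have hs : Small (fun p => ∃ ζ η x y, (Mem ζ η ∨ ζ = η) ∧ Mem η β ∧ App f ζ x ∧ App f η y ∧
        IsOPair p x y) := (small_mem (P (P X))).of_subset hsub
    exact ⟨ofSmall hs, (mem_ofSmall _).2 ⟨isSet_ofSmall hs, fun p hp =>
      hsub p ((mem_ofSmall hs).1 hp)⟩, hβ, f, hf, isSet_ofSmall hs, fun p => mem_ofSmall hs⟩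

/-- Under Plenitude, every ordinal is equinumerous with a set of urelements that avoids a given
set. -/
theorem Plenitude.exists_avoiding (hP : Plenitude M) (A : M) {α : M} (hα : IsOrdinal α) :
    ∃ B, IsUrSet B ∧ (∀ b, Mem b B → ¬ Mem b A) ∧ Equinum B α := by
  have hX : Small (fun x => Mem x α ∨ (Mem x A ∧ Ur x)) :=
    (small_mem α).or (small_sep A fun x => Ur x)
  -- `β` is too large to be injected into `α` together with the urelements in `A`; no well-ordering
  -- of `A` is needed.
  obtain ⟨β, hβ, hβX⟩ := exists_isOrdinal_not_isInj (ofSmall hX)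
  obtain ⟨B₀, hB₀, f₀, hf₀⟩ := hP β hβ
  have hbij : ∀ {b c ξ}, App f₀ b ξ → App f₀ c ξ → b = c := fun {b c ξ} hb hc =>
    (hf₀.2.2 ξ (hf₀.2.1 _ _ hb)).unique hb hc
  -- the collapse of the set of all `ξ ∈ β` that correspond to urelements outside `A`
  let Q : M → Prop := fun ξ => ∃ b, App f₀ b ξ ∧ ¬ Mem b A
  -- The value at urelements is a mere default. For `ξ` in `β`, the value `c ξ` is the order type of
  -- the elements of `ξ` that satisfy `Q`.
  let V : M → M → Prop := RecVal (fun a b => b = a) Q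
  have hB : ∀ a : M, Ur a → ∃! b, b = a := fun a _ => ⟨a, rfl, fun _ h => h⟩
  choose c hc using RecVal.existence (B := fun a b : M => b = a) (Q := Q) hB
  have hcu : ∀ x y, y = c x ↔ V x y := fun x y => ⟨fun h => h ▸ hc x, fun h =>
    RecVal.unique (fun a b c _ h h' => h.trans h'.symm) h (hc x)⟩
  have hcd : DefFun (fun v : Unit → M => c (v ())) :=
    have := @DefPred.recVal M _
    DefFun.of_graph fun v y => hcu (v ()) y
  have hcd' : ∀ {γ : Type} (t : (γ → M) → M) [DefFun t], DefFun (fun v => c (t v)) :=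
    fun t _ => DefFun.subst₁ hcd
  have hcm : ∀ x, IsSet x → IsSet (c x) ∧ ∀ u, Mem u (c x) ↔ ∃ v, Mem v x ∧ Q v ∧ u = c v := by
    intro x hx
    have := (hc x).mem_iff (fun a b c _ h h' => h.trans h'.symm) hx
    simpa only [hcu] using this
  have hco : ∀ x, IsOrdinal x → IsOrdinal (c x) := by
    intro x
    refine mem_induction (P := fun x => IsOrdinal x → IsOrdinal (c x)) (fun x ih hx => ?_) x
    obtain ⟨hcs, hcm'⟩ := hcm x hx.isTransSet.1
    refine IsOrdinal.of_forall_mem ⟨hcs, fun y hy z hz => ?_⟩ fun y hy => ?_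
    · obtain ⟨v, hv, hQv, rfl⟩ := (hcm' y).1 hy
      obtain ⟨w, hw, hQw, rfl⟩ := ((hcm v (hx.of_mem hv).isTransSet.1).2 z).1 hz
      exact (hcm' _).2 ⟨w, hx.isTransSet.2 v hv w hw, hQw, rfl⟩
    · obtain ⟨v, hv, -, rfl⟩ := (hcm' y).1 hy
      exact ih v hv (hx.of_mem hv)
  have hcmem : ∀ {ξ η}, Mem ξ η → Q ξ → Mem (c ξ) (c η) := fun {ξ η} h hξ =>
    ((hcm η h.isSet).2 _).2 ⟨ξ, h, hξ, rfl⟩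
  have hci : ∀ {ξ η}, Mem ξ β → Mem η β → Q ξ → Q η → c ξ = c η → ξ = η := by
    intro ξ η hξ hη hQξ hQη h
    rcases hβ.trichotomy_mem hξ hη with h' | h' | h'
    · exact (not_mem_self _ (h ▸ hcmem h' hQξ)).elim
    · exact h'
    · exact (not_mem_self _ (h ▸ hcmem h' hQη)).elim
  rcases hα.sub_or_sub (hco β hβ) with hsub | hsub
  -- Enough urelements remain outside `A`: those whose collapsed index lies below `α` form the
  -- required set.
  · have hB := small_sep B₀ fun b => ¬ Mem b A ∧ ∃ ξ, App f₀ b ξ ∧ Mem (c ξ) α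
    refine ⟨ofSmall hB, ⟨isSet_ofSmall hB, fun a ha => hB₀.2 a ((mem_ofSmall hB).1 ha).1⟩,
      fun b hb => ((mem_ofSmall hB).1 hb).2.1, ?_⟩
    obtain ⟨f, hf, hfa⟩ := exists_funOn (ofSmall hB) (fun b y => ∃ ξ, App f₀ b ξ ∧ y = c ξ)
      fun b hb => by
        obtain ⟨ξ, hξ, hu⟩ := hf₀.1.2.2 b ((mem_ofSmall hB).1 hb).1
        refine ⟨c ξ, ⟨ξ, hξ, rfl⟩, ?_⟩
        rintro _ ⟨ξ', hξ', rfl⟩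
        rw [hu ξ' hξ']
    refine ⟨f, hf, fun b y hby => ?_, fun y hy => ?_⟩
    · obtain ⟨hb, ξ, hξ, rfl⟩ := (hfa b y).1 hby
      obtain ⟨-, -, ξ', hξ', h⟩ := (mem_ofSmall hB).1 hb
      rwa [hf₀.1.unique hξ hξ']
    · obtain ⟨ξ, hξ, hQξ, rfl⟩ := ((hcm β hβ.isTransSet.1).2 y).1 (hsub y hy)
      obtain ⟨b, hb, hbA⟩ := id hQξ
      refine ⟨b, (hfa b _).2 ⟨(mem_ofSmall hB).2 ⟨hf₀.1.mem_dom hb, hbA, ξ, hb, hy⟩, ξ, hb, rfl⟩,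
        fun b' hb' => ?_⟩
      obtain ⟨hb'B, ξ', hξ', h⟩ := (hfa b' _).1 hb'
      have := hci hξ (hf₀.2.1 _ _ hξ') hQξ ⟨b', hξ', ((mem_ofSmall hB).1 hb'B).2.1⟩ h
      subst this
      exact hbij hξ' hb
  -- Too few remain: sending `ξ` to its urelement if that lies in `A`, and to `c ξ` otherwise,
  -- injects `β` into the set excluded by the choice of `β`. The two kinds of values cannot
  -- coincide, since `c ξ` is a set.
  · obtain ⟨f, hf, hfa⟩ := exists_funOn β
      (fun ξ y => ∃ b, App f₀ b ξ ∧ (Mem b A ∧ y = b ∨ ¬ Mem b A ∧ y = c ξ)) fun ξ hξ => by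
        obtain ⟨b, hb, -⟩ := hf₀.2.2 ξ hξ
        by_cases hbA : Mem b A
        · refine ⟨b, ⟨b, hb, Or.inl ⟨hbA, rfl⟩⟩, ?_⟩
          rintro y ⟨b', hb', h⟩
          obtain rfl := hbij hb hb'
          rcases h with h | h
          · exact h.2
          · exact (h.1 hbA).elim
        · refine ⟨c ξ, ⟨b, hb, Or.inr ⟨hbA, rfl⟩⟩, ?_⟩
          rintro y ⟨b', hb', h⟩
          obtain rfl := hbij hb hb'
          rcases h with h | h
          · exact (hbA h.1).elim
          · exact h.2
    have hur : ∀ {b ξ}, App f₀ b ξ → Ur b := fun {b ξ} hb => hB₀.2 b (hf₀.1.mem_dom hb)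
    have hset : ∀ {ξ}, Mem ξ β → IsSet (c ξ) := fun {ξ} hξ => (hco ξ (hβ.of_mem hξ)).isTransSet.1
    refine (hβX f ⟨hf, fun ξ y hy => ?_, fun ξ η y hfξ hfη => ?_⟩).elim
    · obtain ⟨hξ, b, hb, ⟨hbA, rfl⟩ | ⟨hbA, rfl⟩⟩ := (hfa ξ y).1 hy
      · exact (mem_ofSmall hX).2 (Or.inr ⟨hbA, hur hb⟩)
      · exact (mem_ofSmall hX).2 (Or.inl (hsub _ (hcmem hξ ⟨b, hb, hbA⟩)))
    · obtain ⟨hξ, b, hb, ⟨hbA, rfl⟩ | ⟨hbA, rfl⟩⟩ := (hfa ξ y).1 hfξ <;>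
        obtain ⟨hη, b', hb', ⟨hbA', h⟩ | ⟨hbA', h⟩⟩ := (hfa η _).1 hfη
      · subst h
        exact hf₀.1.unique hb hb'
      · exact (hset hη (h ▸ hur hb)).elim
      · exact (hset hξ (h ▸ hur hb')).elim
      · exact hci hξ hη ⟨b, hb, hbA⟩ ⟨b', hb', hbA'⟩ h

end Ordinals

/-! ### Absoluteness of bijections and ordinals; Plenitude in the permutation model -/

section Absoluteness

theorem existsUnique_coe {M : Type*} {C : Set M} {P : M → Prop} {Q : C → Prop} (h : ∃! y, P y)
    (hPC : ∀ y, P y → y ∈ C) (hPQ : ∀ y : C, P y ↔ Q y) : ∃! y, Q y := by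
  obtain ⟨y, hy, hu⟩ := h
  exact ⟨⟨y, hPC y hy⟩, (hPQ _).1 hy, fun z hz => Subtype.ext (hu z ((hPQ z).2 hz))⟩

variable {M : Type*} [lang.Structure M] [hM : Fact (ZFUR M)] {A G F : M}

theorem isUPair_coe {p x y : permModel A G F} :
    IsUPair (p : M) (x : M) (y : M) ↔ IsUPair p x y := by
  constructor
  · intro h w
    rw [← mem_coe, h, Subtype.ext_iff, Subtype.ext_iff]
  · intro h w
    constructor
    · intro hw
      have := (h ⟨w, mem_permModel_of_mem p.2 hw⟩).1 (mem_coe.1 hw)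
      simpa only [Subtype.ext_iff] using this
    · rintro (rfl | rfl)
      · exact mem_coe.2 ((h x).2 (Or.inl rfl))
      · exact mem_coe.2 ((h y).2 (Or.inr rfl))

theorem isOPair_coe {p x y : permModel A G F} :
    IsOPair (p : M) (x : M) (y : M) ↔ IsOPair p x y := by
  constructor
  · rintro ⟨s, t, hs, ht, hp⟩
    exact ⟨⟨s, mem_permModel_of_mem p.2 ((hp s).2 (Or.inl rfl))⟩,
      ⟨t, mem_permModel_of_mem p.2 ((hp t).2 (Or.inr rfl))⟩,
      isUPair_coe.1 hs, isUPair_coe.1 ht, isUPair_coe.1 hp⟩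
  · rintro ⟨s, t, hs, ht, hp⟩
    exact ⟨s, t, isUPair_coe.2 hs, isUPair_coe.2 ht, isUPair_coe.2 hp⟩

theorem app_coe {f x y : permModel A G F} : App (f : M) (x : M) (y : M) ↔ App f x y := by
  constructor
  · rintro ⟨p, hp, hpf⟩
    exact ⟨⟨p, mem_permModel_of_mem f.2 hpf⟩, isOPair_coe.1 hp, mem_coe.1 hpf⟩
  · rintro ⟨p, hp, hpf⟩
    exact ⟨p, isOPair_coe.2 hp, mem_coe.2 hpf⟩

theorem mem_permModel_of_isOPair {p x y : M} (hp : p ∈ permModel A G F) (h : IsOPair p x y) :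
    x ∈ permModel A G F ∧ y ∈ permModel A G F := by
  obtain ⟨s, t, -, ht, hp'⟩ := h
  have htW := mem_permModel_of_mem hp ((hp' t).2 (Or.inr rfl))
  exact ⟨mem_permModel_of_mem htW ((ht x).2 (Or.inl rfl)),
    mem_permModel_of_mem htW ((ht y).2 (Or.inr rfl))⟩

theorem isBij_coe {f a b : permModel A G F} (h : IsBij (f : M) (a : M) (b : M)) :
    IsBij f a b := by
  have happ : ∀ {x y : M}, App (f : M) x y → x ∈ permModel A G F ∧ y ∈ permModel A G F := by
    rintro x y ⟨p, hp, hpf⟩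
    exact mem_permModel_of_isOPair (mem_permModel_of_mem f.2 hpf) hp
  obtain ⟨⟨hf, hfd, hfu⟩, hfb, hfi⟩ := h
  refine ⟨⟨isSet_coe.1 hf, fun p hp => ?_, fun x hx => ?_⟩, fun x y hxy => ?_, fun y hy => ?_⟩
  · obtain ⟨x, y, hx, hxy⟩ := hfd p (mem_coe.2 hp)
    obtain ⟨hxW, hyW⟩ := mem_permModel_of_isOPair p.2 hxy
    exact ⟨⟨x, hxW⟩, ⟨y, hyW⟩, mem_coe.1 hx, isOPair_coe.1 hxy⟩
  · exact existsUnique_coe (hfu x (mem_coe.2 hx)) (fun y hy => (happ hy).2) fun y => app_coe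
  · exact mem_coe.1 (hfb x y (app_coe.2 hxy))
  · exact existsUnique_coe (hfi y (mem_coe.2 hy)) (fun x hx => (happ hx).1) fun x => app_coe

/-- The model is transitive, and by `IsOrdinal.of_trichotomy` only conditions on the members of `α`
need to be transferred; well-foundedness comes from the universe. -/
theorem isOrdinal_coe {α : permModel A G F} (hα : IsOrdinal α) : IsOrdinal (α : M) := by
  have ht : IsTransSet (α : M) := by
    refine ⟨isSet_coe.2 hα.isTransSet.1, fun y hy => ?_⟩
    exact sub_coe.2 (hα.isTransSet.2 ⟨y, mem_permModel_of_mem α.2 hy⟩ (mem_coe.1 hy))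
  refine IsOrdinal.of_trichotomy ht ((isPure_iff_of_isTransSet ht).2 fun y hy => ?_)
    fun x y hx hy => ?_
  · lift y to permModel A G F using mem_permModel_of_mem α.2 hy
    exact isSet_coe.2 (hα.isPure.of_mem (mem_coe.1 hy)).1
  · lift x to permModel A G F using mem_permModel_of_mem α.2 hx
    lift y to permModel A G F using mem_permModel_of_mem α.2 hy
    simpa only [mem_coe, Subtype.ext_iff] using
      hα.trichotomy_mem (mem_coe.1 hx) (mem_coe.1 hy)

/-- `x` belongs to the permutation model and is fixed by the whole group. -/
def IsFixed (A G F x : M) : Prop :=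
  x ∈ permModel A G F ∧ ∀ π, Mem π G → act A π x = x

namespace NormalSystem

variable (h : NormalSystem A G F)

include h

theorem isFixed_of_forall_mem {x : M} (hx : IsSet x) (hm : ∀ y, Mem y x → IsFixed A G F y) :
    IsFixed A G F x :=
  ⟨h.mem_permModel_of_forall_act_eq hx (fun y hy => (hm y hy).1) fun y hy => (hm y hy).2,
    fun _ hπ => act_eq_self_of_forall_mem h.isUrSet h.isPermGroup hx
      (fun π hπ y hy => ((hm y hy).2 π hπ).symm ▸ hy) hπ⟩

theorem isFixed_upair {x y : M} (hx : IsFixed A G F x) (hy : IsFixed A G F y) :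
    IsFixed A G F (upair x y) :=
  h.isFixed_of_forall_mem (isSet_upair x y) fun z hz => by
    rcases mem_upair.1 hz with rfl | rfl
    · exact hx
    · exact hy

theorem isFixed_opair {x y : M} (hx : IsFixed A G F x) (hy : IsFixed A G F y) :
    IsFixed A G F (opair x y) :=
  h.isFixed_upair (h.isFixed_upair hx hx) (h.isFixed_upair hx hy)

/-- Permutation models inherit Plenitude. -/
theorem plenitude (hP : Plenitude M) : Plenitude (permModel A G F) := by
  intro α hα
  have hα' := isOrdinal_coe hα
  obtain ⟨B, hB, hBA, f, hf⟩ := hP.exists_avoiding A hα'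
  -- Urelements outside `A` are moved by no permutation, and members of `α` are pure; so every pair
  -- in `f` is hereditarily fixed.
  have hb : ∀ b, Mem b B → IsFixed A G F b := fun b hb =>
    ⟨h.mem_permModel_of_ur (hB.2 b hb), fun π hπ =>
      act_of_not_mem (h.isPermGroup.perm π hπ) (hB.2 b hb) (hBA b hb)⟩
  have hBW := h.isFixed_of_forall_mem hB.1 hb
  have hfW : IsFixed A G F f := h.isFixed_of_forall_mem hf.1.1 fun p hp => by
    obtain ⟨x, y, hx, hxy⟩ := hf.1.2.1 p hp
    have hy := hf.2.1 x y ⟨p, hxy, hp⟩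
    obtain rfl := isOPair_iff.1 hxy
    exact h.isFixed_opair (hb x hx) ⟨mem_permModel_of_mem α.2 hy, fun π hπ =>
      h.act_eq_self_of_isPure (hα'.isPure.of_mem hy) hπ⟩
  refine ⟨⟨B, hBW.1⟩, ⟨isSet_coe.1 hB.1, fun a ha => ur_coe.1 (hB.2 a (mem_coe.2 ha))⟩,
    ⟨f, hfW.1⟩, isBij_coe hf⟩

end NormalSystem

end Absoluteness

end UrSet

theorem mainTheorem9 {U : Type*} [UrSet.lang.Structure U] (hU : UrSet.ZFUR U)
    (A G F : U) (hA : UrSet.IsUrSet A) (hG : UrSet.IsPermGroup A G)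
    (hF : UrSet.IsNormalFilter A G F) :
    UrSet.ZFUR (UrSet.permModel A G F) ∧
    (UrSet.Collection U → UrSet.Collection (UrSet.permModel A G F)) ∧
    (UrSet.Plenitude U → UrSet.Plenitude (UrSet.permModel A G F)) ∧
    (UrSet.Reflection U ∧ UrSet.Choice U → UrSet.Reflection (UrSet.permModel A G F)) := by
  have : Fact (UrSet.ZFUR U) := ⟨hU⟩
  have h : UrSet.NormalSystem A G F := ⟨hA, hG, hF⟩
  exact ⟨h.zfur, h.collection, h.plenitude, fun hr => h.reflection hr.1⟩
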